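/- Let $F$ be a real Fréchet space and $M$ a smooth manifold modelled on $F$, smoothness being understood in the Michal–Bastiani sense ($f$ is $C^{k+1}$ if it is continuous, all directional derivatives exist and $(x,h)\mapsto Df(x)(h)$ is $C^k$). Let $\Pi:TM\to M$ be the tangent bundle, and $(x,v,a,b)$ the coordinates on $T(TM)$ induced by a chart of $M$, so that $T\Pi(x,v,a,b)=(x,a)$. For $u\in TM$ let $V_u=\ker T_u\Pi\subset T_u(TM)$ be the vertical space, $\mathrm{Ver}_u(w)=\frac{d}{dt}\big|_{t=0}(u+tw)$ the vertical lift $T_{\Pi(u)}M\to V_u$, and $J_u=\mathrm{Ver}_u\circ T_u\Pi$ the tangent structure. *Connections.* A connection on $TM$ is a smooth morphism $C:T(TM)\to VTM$ of vector bundles over $TM$ with $C|_{VTM}=\mathrm{Id}$; its horizontal spaces are $H_u=\ker C_u$. It is linear if it is also linear on the fibres of $T\Pi:T(TM)\to TM$ (secondary vector bundle structure), and symmetric if $C\circ\mathrm{Inv}=C$ for the canonical involution $\mathrm{Inv}(x,v,a,b)=(x,a,v,b)$, vertical vectors over $x\in M$ being identified with elements of $T_xM$ by $\mathrm{Ver}$.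 *Connection maps.* A spray is a smooth map $S:TM\to T(TM)$ with $\Pi_{TM}\circ S=\mathrm{Id}$, $T\Pi\circ S=\mathrm{Id}$ and $S(su)=(L_s)_*(sS(u))$ for all $s\in\mathbb R$, where $L_s(u)=su$. In a chart $U$ it has the form $(x,v)\mapsto(x,v,v,S_U(x,v))$; put $B_U(x;\cdot,\cdot)=\tfrac12D_2^2S_U(x,0)$. A connection map is a smooth vector bundle morphism $K:T(TM)\to TM$ over $\Pi$ (with fibre maps $K_u:T_u(TM)\to T_{\Pi(u)}M$) for which there is a spray such that in every chart $U$ $$K(x,v,a,b)=\bigl(x,\;b-B_U(x;v,a)\bigr).$$ **Theorem.** 1. Let $C$ be a linear symmetric connection on $TM$. For each $u\in TM$, $J_u$ restricts to a bijection $H_u\to V_u$. With $L_u=(J_u|_{H_u})^{-1}\circ C_u$, the maps $K_u=T_u\Pi\circ L_u$ form a connection map $K$, and $K_u\circ J_u=T_u\Pi$ and $\ker K_u=H_u$ for all $u$. 2. Conversely, let $K:T(TM)\to TM$ be a smooth vector bundle morphism over $\Pi$ with $K_u\circ J_u=T_u\Pi$ for all $u$. Then $T_u(TM)=\ker K_u\oplus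 V_u$ for all $u$, and there is a unique connection $C$ on $TM$ with horizontal spaces $H_u=\ker K_u$. Every connection map $K$ satisfies $K_u\circ J_u=T_u\Pi$ for all $u$, and for it the connection $C$ is linear and symmetric, and the connection map constructed from $C$ in part 1 is $K$. In particular, linear symmetric connections on $TM$ and connection maps determine each other bijectively. -/

import Mathlib

open Set Filter Topology Bundle
open scoped Manifold

set_option linter.unusedSectionVars false

noncomputable section

namespace FrechetGeom

universe u v w v' w'

/-! ### Calculus in locally convex spaces (Michal--Bastiani, Keller's `C_c^k`) -/

section Calculus

/-- `f` has at `x`, in the direction `h`, the directional derivative `y`. -/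
def HasDirDeriv {E : Type u} {F : Type v} [AddCommGroup E] [Module ℝ E]
    [AddCommGroup F] [Module ℝ F] [TopologicalSpace F] (f : E → F) (x h : E) (y : F) : Prop :=
  Tendsto (fun t : ℝ => t⁻¹ • (f (x + t • h) - f x)) (𝓝[≠] 0) (𝓝 y)

/-- The directional derivative `D f (x) (h)`. -/
def dirDeriv {E : Type u} {F : Type v} [AddCommGroup E] [Module ℝ E]
    [AddCommGroup F] [Module ℝ F] [TopologicalSpace F] (f : E → F) (x h : E) : F :=
  limUnder (𝓝[≠] (0 : ℝ)) (fun t : ℝ => t⁻¹ • (f (x + t • h) - f x))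

/-- `f` is of class `C^k` on the open set `U`: it is continuous there and, if `k ≥ 1`, all
directional derivatives exist and `D f : U × E → F` is of class `C^(k-1)`. -/
def CkOn : ℕ → ∀ {E : Type u} {F : Type v} [AddCommGroup E] [Module ℝ E] [TopologicalSpace E]
    [AddCommGroup F] [Module ℝ F] [TopologicalSpace F], Set E → (E → F) → Prop
  | 0, _, _, _, _, _, _, _, _, U, f => ContinuousOn f U
  | k + 1, E, _, _, _, _, _, _, _, U, f =>
      ContinuousOn f U ∧ (∀ x ∈ U, ∀ h, ∃ y, HasDirDeriv f x h y) ∧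
      CkOn k (U ×ˢ (univ : Set E)) (fun p : E × E => dirDeriv f p.1 p.2)

/-- `f` is of class `C^∞` on the open set `U`. -/
def SmoothOn {E : Type u} {F : Type v} [AddCommGroup E] [Module ℝ E] [TopologicalSpace E]
    [AddCommGroup F] [Module ℝ F] [TopologicalSpace F] (U : Set E) (f : E → F) : Prop :=
  ∀ k, CkOn k U f

section
variable {E : Type u} [AddCommGroup E] [Module ℝ E]
  {F : Type v} [AddCommGroup F] [Module ℝ F] [TopologicalSpace F]

theorem HasDirDeriv.dirDeriv_eq [T2Space F] {f : E → F} {x h : E} {y : F}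
    (H : HasDirDeriv f x h y) : dirDeriv f x h = y :=
  Tendsto.limUnder_eq H

theorem HasDirDeriv.hasDirDeriv [T2Space F] {f : E → F} {x h : E} {y : F}
    (H : HasDirDeriv f x h y) : HasDirDeriv f x h (dirDeriv f x h) := by
  rw [H.dirDeriv_eq]; exact H

theorem hasDirDeriv_of_linear [ContinuousSMul ℝ F] (f : E →ₗ[ℝ] F) (x h : E) :
    HasDirDeriv f x h (f h) := by
  refine tendsto_const_nhds.congr' ?_
  filter_upwards [self_mem_nhdsWithin] with t (ht : t ≠ 0)
  simp [map_add, smul_smul, ht]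

theorem tendsto_line [TopologicalSpace E] [IsTopologicalAddGroup E] [ContinuousSMul ℝ E]
    (x h : E) : Tendsto (fun t : ℝ => x + t • h) (𝓝[≠] 0) (𝓝 x) := by
  have : Continuous (fun t : ℝ => x + t • h) := by fun_prop
  have h2 := this.tendsto 0
  simp only [zero_smul, add_zero] at h2
  exact h2.mono_left nhdsWithin_le_nhds

theorem HasDirDeriv.congr_of_eventuallyEq [TopologicalSpace E] [IsTopologicalAddGroup E]
    [ContinuousSMul ℝ E] {f g : E → F} {x h : E} {y : F}
    (H : HasDirDeriv f x h y) (hfg : g =ᶠ[𝓝 x] f) : HasDirDeriv g x h y := by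
  refine Tendsto.congr' ?_ H
  filter_upwards [(tendsto_line x h).eventually hfg] with t ht
  rw [ht, hfg.self_of_nhds]

theorem dirDeriv_congr [TopologicalSpace E] [IsTopologicalAddGroup E]
    [ContinuousSMul ℝ E] {f g : E → F} {x h : E} (hfg : g =ᶠ[𝓝 x] f) :
    dirDeriv g x h = dirDeriv f x h := by
  have : (fun t : ℝ => t⁻¹ • (g (x + t • h) - g x)) =ᶠ[𝓝[≠] 0]
      (fun t : ℝ => t⁻¹ • (f (x + t • h) - f x)) := by
    filter_upwards [(tendsto_line x h).eventually hfg] with t ht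
    rw [ht, hfg.self_of_nhds]
  unfold dirDeriv limUnder
  rw [Filter.map_congr this]
end

variable {E : Type u} [AddCommGroup E] [Module ℝ E] [TopologicalSpace E]
  [IsTopologicalAddGroup E] [ContinuousSMul ℝ E]
  {F : Type v} [AddCommGroup F] [Module ℝ F] [TopologicalSpace F]
  [IsTopologicalAddGroup F] [ContinuousSMul ℝ F]
  {G : Type w} [AddCommGroup G] [Module ℝ G] [TopologicalSpace G]
  [IsTopologicalAddGroup G] [ContinuousSMul ℝ G]

theorem CkOn.continuousOn {k : ℕ} {U : Set E} {f : E → F} (H : CkOn k U f) :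
    ContinuousOn f U := by
  cases k with
  | zero => exact H
  | succ k => exact H.1

theorem CkOn.mono {k : ℕ} {U V : Set E} {f : E → F} (H : CkOn k U f) (h : V ⊆ U) :
    CkOn k V f := by
  induction k generalizing E with
  | zero => exact ContinuousOn.mono H h
  | succ k ih =>
    exact ⟨H.1.mono h, fun x hx => H.2.1 x (h hx), ih H.2.2 (prod_mono h Subset.rfl)⟩

theorem CkOn.congr {k : ℕ} {U : Set E} {f g : E → F} (hU : IsOpen U) (H : CkOn k U f)
    (h : ∀ x ∈ U, g x = f x) : CkOn k U g := by
  induction k generalizing E with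
  | zero => exact ContinuousOn.congr H h
  | succ k ih =>
    have e : ∀ x ∈ U, g =ᶠ[𝓝 x] f := fun x hx =>
      Filter.mem_of_superset (hU.mem_nhds hx) h
    refine ⟨H.1.congr h, fun x hx k => ?_, ih (hU.prod isOpen_univ) H.2.2 ?_⟩
    · obtain ⟨y, hy⟩ := H.2.1 x hx k
      exact ⟨y, hy.congr_of_eventuallyEq (e x hx)⟩
    · rintro ⟨x, k⟩ ⟨hx, -⟩
      exact dirDeriv_congr (e x hx)

theorem CkOn.of_locally {k : ℕ} {U : Set E} {f : E → F}
    (H : ∀ x ∈ U, ∃ V, IsOpen V ∧ x ∈ V ∧ CkOn k (U ∩ V) f) : CkOn k U f := by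
  have hc : ContinuousOn f U := by
    intro x hx
    obtain ⟨V, hV, hxV, hf⟩ := H x hx
    exact (continuousWithinAt_inter (hV.mem_nhds hxV)).1 (hf.continuousOn x ⟨hx, hxV⟩)
  induction k generalizing E with
  | zero => exact hc
  | succ k ih =>
    have hd : ∀ p ∈ U ×ˢ (univ : Set E), ∃ V, IsOpen V ∧ p ∈ V ∧
        CkOn k ((U ×ˢ (univ : Set E)) ∩ V) (fun p : E × E => dirDeriv f p.1 p.2) := by
      rintro ⟨x, h⟩ ⟨hx, -⟩
      obtain ⟨V, hV, hxV, hf⟩ := H x hx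
      refine ⟨V ×ˢ univ, hV.prod isOpen_univ, ⟨hxV, mem_univ _⟩, ?_⟩
      rw [prod_inter_prod, univ_inter]
      exact hf.2.2
    refine ⟨hc, fun x hx => ?_, ih hd ?_⟩
    · obtain ⟨V, hV, hxV, hf⟩ := H x hx
      exact hf.2.1 x ⟨hx, hxV⟩
    · intro p hp
      obtain ⟨V, hV, hxV, hf⟩ := hd p hp
      exact (continuousWithinAt_inter (hV.mem_nhds hxV)).1 (hf.continuousOn p ⟨hp, hxV⟩)

theorem CkOn.of_succ {k : ℕ} {U : Set E} {f : E → F} (H : CkOn (k + 1) U f) : CkOn k U f := by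
  induction k generalizing E with
  | zero => exact H.1
  | succ k ih => exact ⟨H.1, H.2.1, ih H.2.2⟩

theorem ckOn_clm [T2Space F] (k : ℕ) {U : Set E} (hU : IsOpen U) (f : E →L[ℝ] F) :
    CkOn k U f := by
  induction k generalizing E with
  | zero => exact f.continuous.continuousOn
  | succ k ih =>
    refine ⟨f.continuous.continuousOn,
      fun x _ h => ⟨f h, hasDirDeriv_of_linear (f : E →ₗ[ℝ] F) x h⟩, ?_⟩
    refine (ih (hU.prod isOpen_univ) (f.comp (ContinuousLinearMap.snd ℝ E E))).congr
      (hU.prod isOpen_univ) ?_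
    rintro ⟨x, h⟩ -
    exact (hasDirDeriv_of_linear (f : E →ₗ[ℝ] F) x h).dirDeriv_eq

theorem HasDirDeriv.prodMk {f : E → F} {g : E → G} {x h : E} {y : F} {z : G}
    (hf : HasDirDeriv f x h y) (hg : HasDirDeriv g x h z) :
    HasDirDeriv (fun x => (f x, g x)) x h (y, z) := by
  have := Tendsto.prodMk_nhds hf hg
  exact this

theorem CkOn.prodMk [T2Space F] [T2Space G] {k : ℕ} {U : Set E} (hU : IsOpen U)
    {f : E → F} {g : E → G} (hf : CkOn k U f) (hg : CkOn k U g) :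
    CkOn k U (fun x => (f x, g x)) := by
  induction k generalizing E with
  | zero => exact ContinuousOn.prodMk hf hg
  | succ k ih =>
    refine ⟨hf.1.prodMk hg.1, fun x hx h => ?_, ?_⟩
    · obtain ⟨y, hy⟩ := hf.2.1 x hx h
      obtain ⟨z, hz⟩ := hg.2.1 x hx h
      exact ⟨_, hy.prodMk hz⟩
    · refine (ih (hU.prod isOpen_univ) hf.2.2 hg.2.2).congr (hU.prod isOpen_univ) ?_
      rintro ⟨x, h⟩ ⟨hx, -⟩
      obtain ⟨y, hy⟩ := hf.2.1 x hx h
      obtain ⟨z, hz⟩ := hg.2.1 x hx h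
      exact (hy.hasDirDeriv.prodMk hz.hasDirDeriv).dirDeriv_eq

/-- For a `C^1` map, difference quotients along varying directions converge. -/
theorem CkOn.tendsto_quotient [LocallyConvexSpace ℝ F] [T2Space F] {U : Set E} (hU : IsOpen U)
    {f : E → F} (hf : CkOn 1 U f) {x : E} (hx : x ∈ U) (h : E) :
    Tendsto (fun p : ℝ × E => p.1⁻¹ • (f (x + p.1 • p.2) - f x)) (𝓝[≠] 0 ×ˢ 𝓝 h)
      (𝓝 (dirDeriv f x h)) := by
  have hD : ContinuousOn (fun p : E × E => dirDeriv f p.1 p.2) (U ×ˢ univ) := hf.2.2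
  rw [(closed_nhds_basis (dirDeriv f x h)).tendsto_right_iff]
  rintro N ⟨hN, hNc⟩
  obtain ⟨V, hV, hVc, hVN⟩ :=
    (locallyConvexSpace_iff_exists_convex_subset ℝ F).1 inferInstance _ N hN
  have hW : ∀ᶠ p : E × E in 𝓝 (x, h), p.1 ∈ U ∧ dirDeriv f p.1 p.2 ∈ V := by
    have hm : U ×ˢ (univ : Set E) ∈ 𝓝 (x, h) :=
      (hU.prod isOpen_univ).mem_nhds ⟨hx, mem_univ _⟩
    filter_upwards [hm, (hD.continuousAt hm).eventually hV] with p h1 h2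
    exact ⟨h1.1, h2⟩
  have hc : Tendsto (fun q : ℝ × E => (x + q.1 • q.2, q.2)) (𝓝 ((0 : ℝ), h)) (𝓝 (x, h)) := by
    have : Continuous (fun q : ℝ × E => (x + q.1 • q.2, q.2)) := by fun_prop
    have h2 := this.tendsto (0, h)
    simpa using h2
  have hW2 := hc.eventually hW
  rw [nhds_prod_eq, eventually_prod_iff] at hW2
  obtain ⟨pa, hpa, pb, hpb, hab⟩ := hW2
  obtain ⟨δ, hδ, hball⟩ := Metric.eventually_nhds_iff.1 hpa
  have h1 : ∀ᶠ t : ℝ in 𝓝[≠] 0, t ≠ 0 ∧ |t| < δ := by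
    refine (eventually_mem_nhdsWithin).and (nhdsWithin_le_nhds ?_)
    filter_upwards [Metric.ball_mem_nhds (0 : ℝ) hδ] with t ht
    simpa using ht
  filter_upwards [h1.prod_mk hpb] with p hp
  obtain ⟨t, k⟩ := p
  obtain ⟨⟨ht0, htδ⟩, hk⟩ := hp
  dsimp only at ht0 htδ hk ⊢
  have key : ∀ s ∈ Icc (0 : ℝ) 1, x + (s * t) • k ∈ U ∧ dirDeriv f (x + (s * t) • k) k ∈ V := by
    intro s hs
    refine hab (x := s * t) (hball ?_) hk
    rw [Real.dist_eq, sub_zero, abs_mul, abs_of_nonneg hs.1]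
    exact lt_of_le_of_lt (mul_le_of_le_one_left (abs_nonneg t) hs.2) htδ
  suffices hcl : t⁻¹ • (f (x + t • k) - f x) ∈ closure V from
    (hNc.closure_subset_iff.2 hVN) hcl
  by_contra hq
  obtain ⟨l, c, hl, hlq⟩ := geometric_hahn_banach_closed_point hVc.closure isClosed_closure hq
  set g : ℝ → ℝ := fun s => l (f (x + (s * t) • k)) with hg
  have hder : ∀ s ∈ Icc (0 : ℝ) 1,
      HasDerivAt g (t * l (dirDeriv f (x + (s * t) • k) k)) s := by
    intro s hs
    obtain ⟨y, hy⟩ := hf.2.1 _ (key s hs).1 k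
    have hy' := hy.hasDirDeriv
    rw [hasDerivAt_iff_tendsto_slope_zero]
    have h3 : Tendsto (fun r : ℝ => r * t) (𝓝[≠] 0) (𝓝[≠] 0) := by
      refine tendsto_nhdsWithin_iff.2 ⟨?_, ?_⟩
      · have : Tendsto (fun r : ℝ => r * t) (𝓝 0) (𝓝 (0 * t)) := by
          exact (continuous_mul_const t).tendsto 0
        rw [zero_mul] at this
        exact this.mono_left nhdsWithin_le_nhds
      · filter_upwards [self_mem_nhdsWithin] with r hr
        exact mul_ne_zero hr ht0
    have h4 := ((l.continuous.tendsto _).comp (hy'.comp h3)).const_mul t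
    refine h4.congr' ?_
    filter_upwards [self_mem_nhdsWithin] with r (hr : r ≠ 0)
    simp only [Function.comp, hg, map_smul, map_sub, smul_eq_mul]
    have : x + (s * t) • k + (r * t) • k = x + ((s + r) * t) • k := by
      rw [add_assoc, ← add_smul, add_mul]
    rw [this]
    field_simp
  obtain ⟨s, hs, hslope⟩ := exists_hasDerivAt_eq_slope g
    (fun s => t * l (dirDeriv f (x + (s * t) • k) k)) (zero_lt_one)
    (fun s hs => (hder s hs).continuousAt.continuousWithinAt)
    (fun s hs => hder s ⟨hs.1.le, hs.2.le⟩)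
  have hlt := hl _ (subset_closure (key s ⟨hs.1.le, hs.2.le⟩).2)
  have : l (t⁻¹ • (f (x + t • k) - f x)) = l (dirDeriv f (x + (s * t) • k) k) := by
    rw [map_smul, map_sub, smul_eq_mul]
    simp only [hg, one_mul, zero_mul, zero_smul, add_zero, sub_zero, div_one] at hslope
    rw [← hslope]
    field_simp
  rw [this] at hlq
  exact lt_irrefl _ (hlt.trans hlq)

/-- The chain rule. -/
theorem HasDirDeriv.comp [LocallyConvexSpace ℝ G] [T2Space G] {V : Set F} (hV : IsOpen V)
    {g : F → G} (hg : CkOn 1 V g) {f : E → F} {x h : E} {y : F} (hf : HasDirDeriv f x h y)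
    (hx : f x ∈ V) : HasDirDeriv (g ∘ f) x h (dirDeriv g (f x) y) := by
  have h1 : Tendsto (fun t : ℝ => (t, t⁻¹ • (f (x + t • h) - f x))) (𝓝[≠] 0)
      (𝓝[≠] 0 ×ˢ 𝓝 y) := tendsto_id.prodMk hf
  refine ((hg.tendsto_quotient hV hx y).comp h1).congr' ?_
  filter_upwards [self_mem_nhdsWithin] with t (ht : t ≠ 0)
  simp [smul_smul, ht]

theorem CkOn.comp_clm {k : ℕ} {U : Set E} {V : Set F} (hU : IsOpen U)
    {g : F → G} (hg : CkOn k V g) (f : E →L[ℝ] F) (h : MapsTo f U V) : CkOn k U (g ∘ f) := by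
  induction k generalizing E F with
  | zero => exact ContinuousOn.comp hg f.continuous.continuousOn h
  | succ k ih =>
    refine ⟨hg.1.comp f.continuous.continuousOn h, fun x hx k => ?_, ?_⟩
    · obtain ⟨y, hy⟩ := hg.2.1 (f x) (h hx) (f k)
      exact ⟨y, by simpa [HasDirDeriv] using hy⟩
    · refine (ih (hU.prod isOpen_univ) hg.2.2 (f.prodMap f) ?_).congr
        (hU.prod isOpen_univ) ?_
      · rintro ⟨x, k⟩ ⟨hx, -⟩
        exact ⟨h hx, mem_univ _⟩
      · rintro ⟨x, k⟩ -
        simp [dirDeriv]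

theorem CkOn.comp [LocallyConvexSpace ℝ F] [T2Space F]
    [LocallyConvexSpace ℝ G] [T2Space G]
    {k : ℕ} {U : Set E} {V : Set F} (hU : IsOpen U) (hV : IsOpen V)
    {g : F → G} {f : E → F} (hg : CkOn k V g) (hf : CkOn k U f) (h : MapsTo f U V) :
    CkOn k U (g ∘ f) := by
  induction k generalizing E F with
  | zero => exact ContinuousOn.comp hg hf h
  | succ k ih =>
    have hg1 : CkOn 1 V g := by
      clear ih hf
      induction k with
      | zero => exact hg
      | succ k ih => exact ih hg.of_succ
    have hd : ∀ x ∈ U, ∀ k, HasDirDeriv (g ∘ f) x k (dirDeriv g (f x) (dirDeriv f x k)) := by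
      intro x hx k
      obtain ⟨y, hy⟩ := hf.2.1 x hx k
      exact hy.hasDirDeriv.comp hV hg1 (h hx)
    refine ⟨hg.1.comp hf.1 h, fun x hx k => ⟨_, hd x hx k⟩, ?_⟩
    have hUo : IsOpen (U ×ˢ (univ : Set E)) := hU.prod isOpen_univ
    have hfst : CkOn k (U ×ˢ (univ : Set E)) (f ∘ ContinuousLinearMap.fst ℝ E E) :=
      hf.of_succ.comp_clm hUo _ (fun p hp => hp.1)
    refine (ih hUo (hV.prod isOpen_univ) hg.2.2 (hfst.prodMk hUo hf.2.2) ?_).congr hUo ?_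
    · rintro ⟨x, k⟩ ⟨hx, -⟩
      exact ⟨h hx, mem_univ _⟩
    · rintro ⟨x, k⟩ ⟨hx, -⟩
      exact (hd x hx k).dirDeriv_eq

variable (F) in
/-- The groupoid of the `C^∞` diffeomorphisms between open subsets of `F`. -/
def smoothGroupoid [LocallyConvexSpace ℝ F] [T2Space F] : StructureGroupoid F :=
  Pregroupoid.groupoid
    { property := fun f s => IsOpen s → SmoothOn s f
      comp := fun {f g u v} hf hg hu hv huv _ k =>
        CkOn.comp huv hv (hg hv k) ((hf hu k).mono inter_subset_left) (fun _ hx => hx.2)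
      id_mem := fun h k => ckOn_clm k h (ContinuousLinearMap.id ℝ F)
      locality := fun {f u} hu H _ k => CkOn.of_locally fun x hx => by
        obtain ⟨v, hv, hxv, h⟩ := H x hx
        exact ⟨v, hv, hxv, h (hu.inter hv) k⟩
      congr := fun {f g u} hu h H _ k => (H hu k).congr hu h }

end Calculus

/-! ### Smooth manifolds modelled on a locally convex space, and their tangent bundles -/

section Manifolds

variable (F : Type v) [AddCommGroup F] [Module ℝ F] [TopologicalSpace F]
  [IsTopologicalAddGroup F] [ContinuousSMul ℝ F] [LocallyConvexSpace ℝ F] [T2Space F]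
  (M : Type w) [TopologicalSpace M] [ChartedSpace F M]

theorem smoothOn_transition [HasGroupoid M (smoothGroupoid F)] (i j : atlas F M) :
    SmoothOn (i.1.symm ≫ₕ j.1).source (j.1 ∘ i.1.symm) :=
  (mem_groupoid_of_pregroupoid.1
    (HasGroupoid.compatible (G := smoothGroupoid F) i.2 j.2)).1
      (i.1.symm ≫ₕ j.1).open_source

/-- The cocycle of the tangent bundle: over the intersection of two charts `i`, `j`, the tangent
coordinates change by the derivative of `j ∘ i⁻¹`. -/
def tangentCore [HasGroupoid M (smoothGroupoid F)] : FiberBundleCore (atlas F M) M F where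
  baseSet i := i.1.source
  isOpen_baseSet i := i.1.open_source
  indexAt := achart F
  mem_baseSet_at := mem_chart_source F
  coordChange i j x v := dirDeriv (j.1 ∘ i.1.symm) (i.1 x) v
  coordChange_self i x hx v := by
    have h : (i.1 ∘ i.1.symm) =ᶠ[𝓝 (i.1 x)] (LinearMap.id : F →ₗ[ℝ] F) := by
      filter_upwards [i.1.open_target.mem_nhds (i.1.map_source hx)] with y hy
      simp [i.1.right_inv hy]
    rw [dirDeriv_congr h]
    exact (hasDirDeriv_of_linear LinearMap.id _ v).dirDeriv_eq
  continuousOn_coordChange i j := by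
    have h := (smoothOn_transition F M i j 1).2.2
    refine ContinuousOn.comp (t := (i.1.symm ≫ₕ j.1).source ×ˢ univ) h
      (f := fun p : M × F => (i.1 p.1, p.2)) ?_ ?_
    · refine ContinuousOn.prodMk ?_ continuousOn_snd
      exact i.1.continuousOn.comp continuousOn_fst (fun p hp => hp.1.1)
    · rintro ⟨x, v⟩ ⟨⟨h1, h2⟩, -⟩
      exact ⟨by simp [h1, h2], mem_univ _⟩
  coordChange_comp i j k x hx v := by
    obtain ⟨⟨hi, hj⟩, hk⟩ := hx
    have hij : i.1 x ∈ (i.1.symm ≫ₕ j.1).source := by simp [hi, hj]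
    have hjk : j.1 x ∈ (j.1.symm ≫ₕ k.1).source := by simp [hj, hk]
    have e : (j.1 ∘ i.1.symm) (i.1 x) = j.1 x := by simp [hi]
    obtain ⟨y, hy⟩ := (smoothOn_transition F M i j 1).2.1 _ hij v
    have h := HasDirDeriv.comp (j.1.symm ≫ₕ k.1).open_source
      (smoothOn_transition F M j k 1) hy.hasDirDeriv (by rw [e]; exact hjk)
    rw [e] at h
    rw [← h.dirDeriv_eq]
    refine dirDeriv_congr ?_
    filter_upwards [(i.1.symm ≫ₕ j.1).open_source.mem_nhds hij] with y hy
    simp only [OpenPartialHomeomorph.trans_source, OpenPartialHomeomorph.symm_source,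
      mem_inter_iff, mem_preimage] at hy
    simp [hy.2]

variable {M} in
/-- The tangent space of `M` at `x`. A tangent vector is given by its coordinates in the preferred
chart at `x`. -/
def TSpace [HasGroupoid M (smoothGroupoid F)] (_x : M) : Type v := F

section
variable [HasGroupoid M (smoothGroupoid F)] {M}
instance (x : M) : AddCommGroup (TSpace F x) := inferInstanceAs (AddCommGroup F)
instance (x : M) : Module ℝ (TSpace F x) := inferInstanceAs (Module ℝ F)
instance (x : M) : TopologicalSpace (TSpace F x) := inferInstanceAs (TopologicalSpace F)

/-- The coordinates of a tangent vector at `x` in the preferred chart at `x`. -/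
def coord (x : M) : TSpace F x ≃ₗ[ℝ] F := LinearEquiv.refl ℝ F
end

/-- The tangent bundle `TM`: the pairs `⟨x, v⟩` with `v ∈ T_x M`. -/
abbrev TB [HasGroupoid M (smoothGroupoid F)] : Type (max w v) :=
  Bundle.TotalSpace F (TSpace F : M → Type v)

variable [HasGroupoid M (smoothGroupoid F)]

instance : TopologicalSpace (TB F M) := (tangentCore F M).toTopologicalSpace

variable {M} in
/-- The chart `(x, v) ↦ (i x, D i (v))` of `TM` induced by a chart `i` of `M`. -/
def tangentChart (i : atlas F M) : OpenPartialHomeomorph (TB F M) (F × F) :=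
  ((tangentCore F M).localTriv i).toOpenPartialHomeomorph ≫ₕ
    (i.1.prod (OpenPartialHomeomorph.refl F))

theorem tangentChart_source (i : atlas F M) :
    (tangentChart F i).source = TotalSpace.proj ⁻¹' i.1.source := by
  ext u
  simp only [tangentChart, mem_preimage]
  constructor
  · exact fun h => h.1
  · exact fun h => ⟨h, h, mem_univ _⟩

theorem tangentChart_target (i : atlas F M) :
    (tangentChart F i).target = i.1.target ×ˢ univ := by
  ext p
  simp only [tangentChart]
  constructor
  · exact fun h => h.1
  · exact fun h => ⟨h, i.1.map_target h.1, mem_univ _⟩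

instance : ChartedSpace (F × F) (TB F M) where
  atlas := range (tangentChart F)
  chartAt u := tangentChart F (achart F u.proj)
  mem_chart_source u := by
    rw [tangentChart_source]
    exact mem_chart_source F u.proj
  chart_mem_atlas u := mem_range_self _

variable {F M} in
theorem tangentChart_apply (i : atlas F M) (u : TB F M) :
    tangentChart F i u =
      (i.1 u.proj, dirDeriv (i.1 ∘ (chartAt F u.proj).symm) (chartAt F u.proj u.proj) u.snd) :=
  rfl

variable {F M} in
theorem tangentChart_symm_apply (i : atlas F M) (p : F × F) :
    (tangentChart F i).symm p = ⟨i.1.symm p.1,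
      dirDeriv (chartAt F (i.1.symm p.1) ∘ i.1.symm) (i.1 (i.1.symm p.1)) p.2⟩ :=
  rfl

variable {F M} in
theorem tangentChart_symm_trans (i j : atlas F M) (p : F × F)
    (hp : p.1 ∈ (i.1.symm ≫ₕ j.1).source) :
    tangentChart F j ((tangentChart F i).symm p) =
      ((j.1 ∘ i.1.symm) p.1, dirDeriv (j.1 ∘ i.1.symm) p.1 p.2) := by
  simp only [OpenPartialHomeomorph.trans_source, OpenPartialHomeomorph.symm_source,
    mem_inter_iff, mem_preimage] at hp
  have h := (tangentCore F M).coordChange_comp i (achart F (i.1.symm p.1)) j (i.1.symm p.1)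
    ⟨⟨i.1.map_target hp.1, mem_chart_source F _⟩, hp.2⟩ p.2
  rw [tangentChart_symm_apply, tangentChart_apply]
  refine Prod.ext rfl (h.trans ?_)
  change dirDeriv (j.1 ∘ i.1.symm) (i.1 (i.1.symm p.1)) p.2 = _
  rw [i.1.right_inv hp.1]

instance : HasGroupoid (TB F M) (smoothGroupoid (F × F)) := by
  refine hasGroupoid_of_pregroupoid _ ?_
  rintro _ _ ⟨i, rfl⟩ ⟨j, rfl⟩ ho k
  have hs : ∀ p ∈ ((tangentChart F i).symm ≫ₕ tangentChart F j).source,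
      p.1 ∈ (i.1.symm ≫ₕ j.1).source := by
    intro p hp
    rw [OpenPartialHomeomorph.trans_source, OpenPartialHomeomorph.symm_source,
      tangentChart_target, tangentChart_source] at hp
    exact ⟨hp.1.1, hp.2⟩
  have h := smoothOn_transition F M i j
  have h1 := (h k).comp_clm ho (ContinuousLinearMap.fst ℝ F F) hs
  have h2 := (h (k + 1)).2.2.mono (V := ((tangentChart F i).symm ≫ₕ tangentChart F j).source)
    (fun p hp => ⟨hs p hp, mem_univ _⟩)
  exact (h1.prodMk ho h2).congr ho (fun p hp => tangentChart_symm_trans i j p (hs p hp))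

end Manifolds

/-! ### Smooth maps, tangent maps and the double tangent bundle -/

section Maps

variable (E : Type v) [AddCommGroup E] [Module ℝ E] [TopologicalSpace E]
  [IsTopologicalAddGroup E] [ContinuousSMul ℝ E] [LocallyConvexSpace ℝ E] [T2Space E]
  (F : Type v') [AddCommGroup F] [Module ℝ F] [TopologicalSpace F]
  [IsTopologicalAddGroup F] [ContinuousSMul ℝ F] [LocallyConvexSpace ℝ F] [T2Space F]
  {M : Type w} [TopologicalSpace M] [ChartedSpace E M]
  {N : Type w'} [TopologicalSpace N] [ChartedSpace F N]

/-- `f : M → N` is of class `C^∞`: it is continuous and smooth in all charts of the two atlases. -/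
def IsSmooth (f : M → N) : Prop :=
  Continuous f ∧ ∀ i ∈ atlas E M, ∀ j ∈ atlas F N,
    SmoothOn (i.target ∩ i.symm ⁻¹' (f ⁻¹' j.source)) (j ∘ f ∘ i.symm)

variable [HasGroupoid M (smoothGroupoid E)] [HasGroupoid N (smoothGroupoid F)]

/-- The tangent map `T_x f : T_x M → T_{f x} N`, computed in the preferred charts (in which tangent
vectors at `x` and `f x` are given). -/
def tangentMapAt (f : M → N) (x : M) (v : TSpace E x) : TSpace F (f x) :=
  (coord F (f x)).symm
    (dirDeriv (chartAt F (f x) ∘ f ∘ (chartAt E x).symm) (chartAt E x x) (coord E x v))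

/-- The tangent map `Tf : TM → TN`. -/
def tangentMap (f : M → N) (u : TB E M) : TB F N :=
  ⟨f u.proj, tangentMapAt E F f u.proj u.snd⟩

end Maps

section DoubleTangent

variable (F : Type v) [AddCommGroup F] [Module ℝ F] [TopologicalSpace F]
  [IsTopologicalAddGroup F] [ContinuousSMul ℝ F] [LocallyConvexSpace ℝ F] [T2Space F]
  (M : Type w) [TopologicalSpace M] [ChartedSpace F M] [HasGroupoid M (smoothGroupoid F)]

/-- The double tangent bundle `T(TM)`. -/
abbrev TTB : Type (max w v) := TB (F × F) (TB F M)

variable {M}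

/-- The chart `(x, v, a, b)` of `T(TM)` induced by a chart `i` of `M`. -/
def tangentChart₂ (i : atlas F M) : OpenPartialHomeomorph (TTB F M) ((F × F) × (F × F)) :=
  tangentChart (F × F) ⟨tangentChart F i, mem_range_self i⟩

variable {F}

/-- `T_u Π : T_u(TM) → T_{Π u} M`, for the projection `Π : TM → M`. -/
def TProj (u : TB F M) : TSpace (F × F) u → TSpace F u.proj :=
  tangentMapAt (F × F) F (TotalSpace.proj : TB F M → M) u

/-- In the preferred chart, the tangent map of the projection is `(a, b) ↦ a`. -/
theorem TProj_apply (u : TB F M) (ξ : TSpace (F × F) u) :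
    TProj u ξ = (coord F u.proj).symm (coord (F × F) u ξ).1 := by
  have h : (chartAt F u.proj ∘ TotalSpace.proj ∘ (chartAt (F × F) u).symm)
      =ᶠ[𝓝 (chartAt (F × F) u u)] LinearMap.fst ℝ F F := by
    filter_upwards [(chartAt (F × F) u).open_target.mem_nhds
      ((chartAt (F × F) u).map_source (mem_chart_source _ u))] with p hp
    have hp' : p ∈ (tangentChart F (achart F u.proj)).target := hp
    rw [tangentChart_target] at hp'
    exact (chartAt F u.proj).right_inv hp'.1
  exact congrArg (coord F u.proj).symm ((dirDeriv_congr h).trans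
    (hasDirDeriv_of_linear (LinearMap.fst ℝ F F) _ (coord (F × F) u ξ)).dirDeriv_eq)

/-- The vertical space `V_u = ker T_u Π`. -/
def vert (u : TB F M) : Submodule ℝ (TSpace (F × F) u) where
  carrier := {ξ | TProj u ξ = 0}
  add_mem' := by
    intro ξ η hξ hη
    simp only [mem_ofPred_eq, TProj_apply, LinearEquiv.map_eq_zero_iff] at *
    simp [hξ, hη]
  zero_mem' := by
    simp [TProj_apply]
  smul_mem' := by
    intro c ξ hξ
    simp only [mem_ofPred_eq, TProj_apply, LinearEquiv.map_eq_zero_iff] at *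
    simp [hξ]

/-- The vertical lift `Ver_u (w) = d/dt|_{t=0} (u + t w)`. -/
def verticalLift (u : TB F M) (w : TSpace F u.proj) : TSpace (F × F) u :=
  (coord (F × F) u).symm
    (dirDeriv (fun t : ℝ => chartAt (F × F) u (⟨u.proj, u.snd + t • w⟩ : TB F M)) 0 1)

/-- The tangent structure `J_u = Ver_u ∘ T_u Π`. -/
def tangentStructure (u : TB F M) (ξ : TSpace (F × F) u) : TSpace (F × F) u :=
  verticalLift u (TProj u ξ)

/-- Multiplication by `s` in the fibres of `TM`. -/
def scale (s : ℝ) (u : TB F M) : TB F M := ⟨u.proj, s • u.snd⟩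

/-- The canonical involution of `T(TM)`: in the chart `(x, v, a, b)` of `T(TM)` induced by the
preferred chart of `M` at the base point (equivalently in the one induced by any other chart,
second derivatives being symmetric), it is `(x, v, a, b) ↦ (x, a, v, b)`. -/
def involution (ξ : TTB F M) : TTB F M :=
  ⟨⟨ξ.proj.proj, (coord F ξ.proj.proj).symm (coord (F × F) ξ.proj ξ.snd).1⟩,
    (coord (F × F) _).symm
      (coord F ξ.proj.proj ξ.proj.snd, (coord (F × F) ξ.proj ξ.snd).2)⟩

/-- The addition of the secondary vector bundle structure `TΠ : T(TM) → TM`, that is the tangent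
map of the addition of `TM`: two vectors `ξ ∈ T_v(TM)`, `η ∈ T_w(TM)` with `TΠ ξ = TΠ η`, where
`v, w ∈ T_x M`, are sent to a vector in `T_(v + w)(TM)`. In a chart it is
`(x, v, a, b), (x, w, a, c) ↦ (x, v + w, a, b + c)`. -/
def secAdd {x : M} {v w : TSpace F x} (ξ : TSpace (F × F) (⟨x, v⟩ : TB F M))
    (η : TSpace (F × F) (⟨x, w⟩ : TB F M)) : TSpace (F × F) (⟨x, v + w⟩ : TB F M) :=
  (coord (F × F) _).symm
    ((coord (F × F) _ ξ).1, (coord (F × F) _ ξ).2 + (coord (F × F) _ η).2)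

/-- The multiplication by `s` in the secondary vector bundle structure `TΠ : T(TM) → TM`, that is
the tangent map of the multiplication by `s` in `TM`. In a chart it is
`(x, v, a, b) ↦ (x, s v, a, s b)`. -/
def secSmul (s : ℝ) (u : TB F M) (ξ : TSpace (F × F) u) : TSpace (F × F) (scale s u) :=
  tangentMapAt (F × F) (F × F) (scale s) u ξ

end DoubleTangent

/-! ### Connections, sprays and connection maps -/

section Connections

variable (F : Type v) [AddCommGroup F] [Module ℝ F] [TopologicalSpace F]
  [IsTopologicalAddGroup F] [ContinuousSMul ℝ F] [LocallyConvexSpace ℝ F] [T2Space F]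
  (M : Type w) [TopologicalSpace M] [ChartedSpace F M] [HasGroupoid M (smoothGroupoid F)]

/-- A (smooth, nonlinear) connection on `TM`: a smooth morphism `T(TM) → VTM` of vector bundles
over `TM` which is a left splitting of `0 → VTM → T(TM) → Π^*TM → 0`. -/
structure Connection where
  /-- the fibrewise linear maps `C_u : T_u(TM) → T_u(TM)` -/
  toFun : ∀ u : TB F M, TSpace (F × F) u →ₗ[ℝ] TSpace (F × F) u
  mem_vert : ∀ u ξ, toFun u ξ ∈ vert u
  eq_self : ∀ u, ∀ ξ ∈ vert u, toFun u ξ = ξ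
  smooth : IsSmooth ((F × F) × (F × F)) ((F × F) × (F × F))
    (fun ξ : TTB F M => (⟨ξ.proj, toFun ξ.proj ξ.snd⟩ : TTB F M))

/-- A smooth vector bundle morphism `K : T(TM) → TM` over `Π : TM → M`. -/
structure ProjMorphism where
  /-- the fibrewise linear maps `K_u : T_u(TM) → T_{Π u} M` -/
  toFun : ∀ u : TB F M, TSpace (F × F) u →ₗ[ℝ] TSpace F u.proj
  smooth : IsSmooth ((F × F) × (F × F)) (F × F)
    (fun ξ : TTB F M => (⟨ξ.proj.proj, toFun ξ.proj ξ.snd⟩ : TB F M))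

/-- A smooth spray: a second-order vector field `S` on `TM` with `S(s u) = (L_s)_* (s S(u))`, where
`L_s` is the multiplication by `s` in `TM`. -/
structure Spray where
  /-- the vectors `S(u) ∈ T_u(TM)` -/
  toFun : ∀ u : TB F M, TSpace (F × F) u
  smooth : IsSmooth (F × F) ((F × F) × (F × F)) (fun u : TB F M => (⟨u, toFun u⟩ : TTB F M))
  second_order : ∀ u, TProj u (toFun u) = u.snd
  homogeneous : ∀ (s : ℝ) (u : TB F M),
    toFun (scale s u) = tangentMapAt (F × F) (F × F) (scale s) u (s • toFun u)

variable {F M}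

namespace Connection

variable (C : Connection F M)

/-- The horizontal space `H_u = ker C_u`. -/
def hor (u : TB F M) : Submodule ℝ (TSpace (F × F) u) := LinearMap.ker (C.toFun u)

/-- A connection is linear if `C : T(TM) → VTM → T(TM)` is linear on the fibres of
`TΠ : T(TM) → TM`, for the secondary vector bundle structure. -/
def IsLinear : Prop :=
  (∀ (x : M) (v w : TSpace F x) (ξ : TSpace (F × F) (⟨x, v⟩ : TB F M))
    (η : TSpace (F × F) (⟨x, w⟩ : TB F M)), TProj _ ξ = TProj _ η →
      C.toFun _ (secAdd ξ η) = secAdd (C.toFun _ ξ) (C.toFun _ η)) ∧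
  (∀ (s : ℝ) (u : TB F M) (ξ : TSpace (F × F) u),
    C.toFun _ (secSmul s u ξ) = secSmul s u (C.toFun u ξ))

/-- A connection is symmetric if `C ∘ Inv = C`. Since `ξ` and `Inv ξ` sit over different points `u`,
`u'` of the same tangent space `T_x M`, the two values are compared in `T_x M`, through the
identifications of the vertical spaces `V_u` and `V_u'` with `T_x M`. -/
def IsSymmetric : Prop :=
  ∀ (ξ : TTB F M) (w : TSpace F ξ.proj.proj), C.toFun ξ.proj ξ.snd = verticalLift ξ.proj w →
    C.toFun (involution ξ).proj (involution ξ).snd = verticalLift (involution ξ).proj w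

/-- `L_u = (J_u|H_u)⁻¹ ∘ C_u`, where `J_u|H_u : H_u → V_u` is the restriction of the tangent
structure. -/
def L (u : TB F M) (ξ : TSpace (F × F) u) : TSpace (F × F) u :=
  Function.invFunOn (tangentStructure u) (C.hor u : Set (TSpace (F × F) u)) (C.toFun u ξ)

end Connection

namespace Spray

variable (S : Spray F M) (i : atlas F M)

/-- In the chart induced by `i`, a spray is `(x, v) ↦ (x, v, v, S_i(x, v))`; this is `S_i`. -/
def localRep (x v : F) : F :=
  (tangentChart₂ F i ⟨(tangentChart F i).symm (x, v), S.toFun ((tangentChart F i).symm (x, v))⟩).2.2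

/-- The symmetric bilinear map `B_i(x; v, w) = 1/2 D_2^2 S_i(x, 0)(v, w)` associated with the
spray in the chart `i`. -/
def bilin (x v w : F) : F :=
  (2 : ℝ)⁻¹ • dirDeriv (fun z => dirDeriv (S.localRep i x) z v) 0 w

end Spray

/-- `K` is a connection map: the connection map associated with some spray `S`, whose
representation in the chart induced by any chart `i` of `M` is
`(x, v, a, b) ↦ (x, b - B_i(x; v, a))`. -/
def ProjMorphism.IsConnectionMap (K : ProjMorphism F M) : Prop :=
  ∃ S : Spray F M, ∀ (i : atlas F M), ∀ x ∈ i.1.target, ∀ v a b : F,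
    tangentChart F i
      ⟨((tangentChart₂ F i).symm ((x, v), (a, b))).proj.proj,
        K.toFun _ ((tangentChart₂ F i).symm ((x, v), (a, b))).snd⟩ = (x, b - S.bilin i x v a)

end Connections

end FrechetGeom

end

/-! Fix u = (p, v) and use the preferred chart at p. It identifies T_u(TM) with pairs (a, b) of
vectors of T_pM (`split`), and every structure in the theorem becomes algebraic: TΠ(a, b) = a,
Ver(w) = (0, w), J(a, b) = (0, a), and Inv exchanges v and a. A connection is C_u(a, b) = (0, K_u(a,
b)) with K_u(0, w) = w, and this last equation is exactly K ∘ J = TΠ. So C = Ver ∘ K matches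
connections with the morphisms K satisfying K ∘ J = TΠ. It preserves kernels, and smoothness passes
both ways (`isSmooth_verticalMorphism_iff`). Moreover J ∘ L = C gives TΠ ∘ L = K. Since C_u is the
projector onto V_u along H_u, the horizontal spaces determine C.

Linearity and symmetry enter through the common normal form K(a, b) = b - Γ_p(v, a), with Γ_p
symmetric and bilinear (`ProjMorphism.HasChristoffel`). A linear symmetric connection has it,
because (a, b) = (a, 0) + (0, b) and the secondary linearity makes K_u(a, 0) linear in v. A
connection map has it, by reading its definition at p in the preferred chart there. Conversely, the
normal form gives back linearity and symmetry of C. It also gives the spray S(v) = (v, Γ(v, v)),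
whose local form in an arbitrary chart is the diagonal of Γ plus the second derivative of the change
of charts. Half its second derivative at 0 is then the polarised form.

The analytic input is that derivatives are linear in the direction and second derivatives are
symmetric. Continuous functionals separate points, so both reduce to real functions on planes. -/

noncomputable section

namespace FrechetGeom

/-! ### Linearity of the derivative and Schwarz' theorem in locally convex spaces. -/

section Calculus

universe u v w

variable {E : Type u} [AddCommGroup E] [Module ℝ E] [TopologicalSpace E]
  [IsTopologicalAddGroup E] [ContinuousSMul ℝ E]
  {F : Type v} [AddCommGroup F] [Module ℝ F] [TopologicalSpace F]
  [IsTopologicalAddGroup F] [ContinuousSMul ℝ F]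

theorem HasDirDeriv.add {f g : E → F} {x h : E} {y z : F}
    (hf : HasDirDeriv f x h y) (hg : HasDirDeriv g x h z) :
    HasDirDeriv (fun p => f p + g p) x h (y + z) := by
  refine (Tendsto.add hf hg).congr fun t => ?_
  rw [← smul_add, add_sub_add_comm]

theorem HasDirDeriv.const_smul {f : E → F} {x h : E} {y : F} (c : ℝ)
    (hf : HasDirDeriv f x h y) : HasDirDeriv (fun p => c • f p) x h (c • y) := by
  refine (Tendsto.const_smul hf c).congr fun t => ?_
  rw [← smul_sub, smul_comm]

theorem HasDirDeriv.clm_comp {G : Type w} [AddCommGroup G] [Module ℝ G] [TopologicalSpace G]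
    (l : F →L[ℝ] G) {f : E → F} {x h : E} {y : F} (hf : HasDirDeriv f x h y) :
    HasDirDeriv (fun p => l (f p)) x h (l y) := by
  refine ((l.continuous.tendsto y).comp hf).congr fun t => ?_
  simp

theorem HasDirDeriv.smul_dir {f : E → F} {x h : E} {y : F} (c : ℝ)
    (hf : HasDirDeriv f x h y) : HasDirDeriv f x (c • h) (c • y) := by
  -- The substitution r ↦ r c preserves the punctured neighbourhoods of 0 only for c ≠ 0.
  rcases eq_or_ne c 0 with rfl | hc
  · simpa [HasDirDeriv] using tendsto_const_nhds
  have h3 : Tendsto (fun r : ℝ => r * c) (𝓝[≠] 0) (𝓝[≠] 0) := by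
    refine tendsto_nhdsWithin_iff.2 ⟨?_, ?_⟩
    · have : Tendsto (fun r : ℝ => r * c) (𝓝 0) (𝓝 (0 * c)) := (continuous_mul_const c).tendsto 0
      rw [zero_mul] at this
      exact this.mono_left nhdsWithin_le_nhds
    · filter_upwards [self_mem_nhdsWithin] with r hr
      exact mul_ne_zero hr hc
  refine ((Tendsto.comp hf h3).const_smul c).congr fun t => ?_
  simp only [Function.comp, smul_smul, mul_inv]
  rw [mul_comm t⁻¹, ← mul_assoc, mul_inv_cancel₀ hc, one_mul]

theorem HasDirDeriv.hasDerivAt {f : E → ℝ} {y a : E} {s d : ℝ}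
    (hf : HasDirDeriv f (y + s • a) a d) : HasDerivAt (fun t : ℝ => f (y + t • a)) d s := by
  rw [hasDerivAt_iff_tendsto_slope_zero]
  refine Tendsto.congr (fun t => ?_) hf
  simp only [add_smul, add_assoc]

theorem ckOn_const [T2Space F] (k : ℕ) {U : Set E} (hU : IsOpen U) (c : F) :
    CkOn k U (fun _ => c) := by
  cases k with
  | zero => exact continuousOn_const
  | succ k =>
    have h0 : ∀ x h : E, HasDirDeriv (fun _ : E => c) x h 0 := by
      intro x h
      simp [HasDirDeriv]
    refine ⟨continuousOn_const, fun x _ h => ⟨0, h0 x h⟩, ?_⟩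
    refine (ckOn_clm k (hU.prod isOpen_univ) (0 : E × E →L[ℝ] F)).congr
      (hU.prod isOpen_univ) ?_
    rintro ⟨x, h⟩ -
    exact (h0 x h).dirDeriv_eq

theorem CkOn.hasDirDeriv [T2Space F] {U : Set E} {f : E → F} (hf : CkOn 1 U f) {x : E}
    (hx : x ∈ U) (h : E) : HasDirDeriv f x h (dirDeriv f x h) := by
  obtain ⟨y, hy⟩ := hf.2.1 x hx h
  exact hy.hasDirDeriv

theorem CkOn.dirDeriv_smul [T2Space F] {U : Set E} {f : E → F} (hf : CkOn 1 U f) {x : E}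
    (hx : x ∈ U) (c : ℝ) (h : E) : dirDeriv f x (c • h) = c • dirDeriv f x h :=
  ((hf.hasDirDeriv hx h).smul_dir c).dirDeriv_eq

/-- Both partial derivatives of the restriction to the plane are continuous, so the classical
criterion in two real variables applies. This brings finite-dimensional calculus to bear on
directional derivatives. -/
theorem CkOn.hasStrictFDerivAt_plane {U : Set E} (hU : IsOpen U) {f : E → ℝ} (hf : CkOn 1 U f)
    {x a b : E} {p : ℝ × ℝ} (hp : x + p.1 • a + p.2 • b ∈ U) :
    HasStrictFDerivAt (fun q : ℝ × ℝ => f (x + q.1 • a + q.2 • b))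
      (dirDeriv f (x + p.1 • a + p.2 • b) a • ContinuousLinearMap.fst ℝ ℝ ℝ +
        dirDeriv f (x + p.1 • a + p.2 • b) b • ContinuousLinearMap.snd ℝ ℝ ℝ) p := by
  have hc : Continuous (fun q : ℝ × ℝ => x + q.1 • a + q.2 • b) := by fun_prop
  have hev : ∀ᶠ q in 𝓝 p, x + q.1 • a + q.2 • b ∈ U := hc.continuousAt (hU.mem_nhds hp)
  have hcont : ∀ c : E, ContinuousAt
      (fun q : ℝ × ℝ => dirDeriv f (x + q.1 • a + q.2 • b) c) p := fun c => by
    have h1 : ContinuousAt (fun z : E × E => dirDeriv f z.1 z.2) (x + p.1 • a + p.2 • b, c) :=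
      hf.2.2.continuousAt ((hU.prod isOpen_univ).mem_nhds ⟨hp, mem_univ _⟩)
    exact ContinuousAt.comp (f := fun q : ℝ × ℝ => (x + q.1 • a + q.2 • b, c)) h1
      (hc.prodMk continuous_const).continuousAt
  have hsp : ∀ c : E, ContinuousAt (fun q : ℝ × ℝ =>
      ContinuousLinearMap.toSpanSingleton ℝ (dirDeriv f (x + q.1 • a + q.2 • b) c)) p := fun c =>
    (ContinuousLinearMap.toSpanSingletonCLE (𝕜 := ℝ) (E := ℝ)).continuous.continuousAt.comp (hcont c)
  have key := hasStrictFDerivAt_uncurry_coprod (𝕜 := ℝ) (u := p)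
    (f := fun s t : ℝ => f (x + s • a + t • b))
    (f₁ := fun s t => ContinuousLinearMap.toSpanSingleton ℝ (dirDeriv f (x + s • a + t • b) a))
    (f₂ := fun s t => ContinuousLinearMap.toSpanSingleton ℝ (dirDeriv f (x + s • a + t • b) b))
    ?_ ?_ (hsp a) (hsp b)
  · refine key.congr_fderiv ?_
    ext <;> simp [Function.HasUncurry.uncurry]
  · filter_upwards [hev] with q hq
    have e : ∀ s : ℝ, x + s • a + q.2 • b = x + q.2 • b + s • a := fun s => by abel
    have h2 := (hf.hasDirDeriv hq a)
    rw [e] at h2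
    have h3 := h2.hasDerivAt.hasFDerivAt
    simp only [← e] at h3
    exact h3
  · filter_upwards [hev] with q hq
    exact (hf.hasDirDeriv hq b).hasDerivAt.hasFDerivAt

/-- Hahn–Banach; it reduces identities between derivatives to real-valued functions. -/
theorem eq_of_forall_dual_eq [LocallyConvexSpace ℝ F] [T2Space F] {y z : F}
    (h : ∀ l : F →L[ℝ] ℝ, l y = l z) : y = z := by
  by_contra hne
  obtain ⟨l, hl⟩ := geometric_hahn_banach_point_point hne
  exact hl.ne (h l)

/-- The derivative of a `C^1` map is additive in the direction. -/
theorem CkOn.dirDeriv_add [LocallyConvexSpace ℝ F] [T2Space F] {U : Set E} (hU : IsOpen U)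
    {f : E → F} (hf : CkOn 1 U f) {x : E} (hx : x ∈ U) (a b : E) :
    dirDeriv f x (a + b) = dirDeriv f x a + dirDeriv f x b := by
  refine eq_of_forall_dual_eq fun l => ?_
  have hl : CkOn 1 U (l ∘ f) :=
    CkOn.comp hU isOpen_univ (ckOn_clm 1 isOpen_univ l) hf (mapsTo_univ _ _)
  have hd : ∀ h, dirDeriv (l ∘ f) x h = l (dirDeriv f x h) := fun h =>
    ((hf.hasDirDeriv hx h).clm_comp l).dirDeriv_eq
  -- The direction a + b is (1, 1) in the plane spanned by a and b, where the differential is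
  -- already linear.
  have h1 := (hl.hasStrictFDerivAt_plane hU (x := x) (a := a) (b := b) (p := 0)
    (by simpa using hx)).hasFDerivAt.hasLineDerivAt (1, 1)
  rw [hasLineDerivAt_iff_tendsto_slope_zero] at h1
  have h2 : HasDirDeriv (l ∘ f) x (a + b) (l (dirDeriv f x a) + l (dirDeriv f x b)) := by
    simpa [HasDirDeriv, hd, add_assoc] using h1
  rw [map_add, ← hd, h2.dirDeriv_eq]

/-- The partial map `x ↦ D f (x) (a)` of a `C^(k+1)` map is `C^k`. -/
theorem CkOn.dirDeriv_left [LocallyConvexSpace ℝ E] [T2Space E] [LocallyConvexSpace ℝ F]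
    [T2Space F] {k : ℕ} {U : Set E} (hU : IsOpen U) {f : E → F} (hf : CkOn (k + 1) U f) (a : E) :
    CkOn k U (fun x => dirDeriv f x a) :=
  CkOn.comp (f := fun x => (x, a)) hU (hU.prod isOpen_univ) hf.2.2
    ((ckOn_clm k hU (ContinuousLinearMap.id ℝ E)).prodMk hU (ckOn_const k hU a))
    (fun _ hx => ⟨hx, mem_univ _⟩)

/-- Schwarz' theorem: the second derivative of a `C^2` map is symmetric. -/
theorem CkOn.dirDeriv_comm [LocallyConvexSpace ℝ E] [T2Space E] [LocallyConvexSpace ℝ F]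
    [T2Space F] {U : Set E} (hU : IsOpen U) {f : E → F} (hf : CkOn 2 U f) {x : E} (hx : x ∈ U)
    (a b : E) : dirDeriv (fun z => dirDeriv f z a) x b = dirDeriv (fun z => dirDeriv f z b) x a := by
  refine eq_of_forall_dual_eq fun l => ?_
  have hl : CkOn 2 U (l ∘ f) :=
    CkOn.comp hU isOpen_univ (ckOn_clm 2 isOpen_univ l) hf (mapsTo_univ _ _)
  have hd : ∀ z ∈ U, ∀ h, dirDeriv (l ∘ f) z h = l (dirDeriv f z h) := fun z hz h =>
    ((hf.of_succ.hasDirDeriv hz h).clm_comp l).dirDeriv_eq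
  have hdd : ∀ c h, dirDeriv (fun z => dirDeriv (l ∘ f) z c) x h
      = l (dirDeriv (fun z => dirDeriv f z c) x h) := fun c h => by
    have h1 := (((hf.dirDeriv_left hU c).hasDirDeriv hx h).clm_comp l).dirDeriv_eq
    rw [← h1]
    refine dirDeriv_congr ?_
    filter_upwards [hU.mem_nhds hx] with z hz
    exact hd z hz c
  rw [← hdd, ← hdd]
  have hc : Continuous (fun q : ℝ × ℝ => x + q.1 • a + q.2 • b) := by fun_prop
  have hp : x + (0 : ℝ × ℝ).1 • a + (0 : ℝ × ℝ).2 • b ∈ U := by simpa using hx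
  have hev : ∀ᶠ q in 𝓝 (0 : ℝ × ℝ), x + q.1 • a + q.2 • b ∈ U :=
    hc.continuousAt (hU.mem_nhds hp)
  have h1 := hev.mono fun q hq =>
    (hl.of_succ.hasStrictFDerivAt_plane hU (a := a) (b := b) hq).hasFDerivAt
  -- The differential on the plane has coefficients D(l ∘ f)(·)(a) and D(l ∘ f)(·)(b), which are
  -- again C^1, so it can be differentiated once more and the classical symmetry used.
  have h2 := ((((hl.dirDeriv_left hU a).hasStrictFDerivAt_plane hU (a := a) (b := b)
      hp).hasFDerivAt.smul_const (ContinuousLinearMap.fst ℝ ℝ ℝ)).add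
    (((hl.dirDeriv_left hU b).hasStrictFDerivAt_plane hU (a := a) (b := b)
      hp).hasFDerivAt.smul_const (ContinuousLinearMap.snd ℝ ℝ ℝ)))
  have h3 := second_derivative_symmetric_of_eventually_of_real h1 h2 (0, 1) (1, 0)
  simpa using h3

end Calculus

/-! ### Second derivatives as symmetric bilinear maps. -/

section Hessian

universe u v

variable {E : Type u} [AddCommGroup E] [Module ℝ E] [TopologicalSpace E]
  [IsTopologicalAddGroup E] [ContinuousSMul ℝ E] [LocallyConvexSpace ℝ E] [T2Space E]
  {F : Type v} [AddCommGroup F] [Module ℝ F] [TopologicalSpace F]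
  [IsTopologicalAddGroup F] [ContinuousSMul ℝ F] [LocallyConvexSpace ℝ F] [T2Space F]

/-- The derivative of a `C^1` map as a linear map. -/
def derivMap {U : Set E} (hU : IsOpen U) {f : E → F} (hf : CkOn 1 U f) {x : E} (hx : x ∈ U) :
    E →ₗ[ℝ] F where
  toFun := dirDeriv f x
  map_add' := hf.dirDeriv_add hU hx
  map_smul' := hf.dirDeriv_smul hx

/-- The second derivative of a `C^2` map as a bilinear map. -/
def hessian {U : Set E} (hU : IsOpen U) {f : E → F} (hf : CkOn 2 U f) {x : E} (hx : x ∈ U) :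
    E →ₗ[ℝ] E →ₗ[ℝ] F :=
  LinearMap.mk₂ ℝ (fun v a => dirDeriv (fun z => dirDeriv f z v) x a)
    (fun v w a => by
      rw [← (((hf.dirDeriv_left hU v).hasDirDeriv hx a).add
        ((hf.dirDeriv_left hU w).hasDirDeriv hx a)).dirDeriv_eq]
      refine dirDeriv_congr ?_
      filter_upwards [hU.mem_nhds hx] with z hz
      exact hf.of_succ.dirDeriv_add hU hz v w)
    (fun c v a => by
      rw [← (((hf.dirDeriv_left hU v).hasDirDeriv hx a).const_smul c).dirDeriv_eq]
      refine dirDeriv_congr ?_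
      filter_upwards [hU.mem_nhds hx] with z hz
      exact hf.of_succ.dirDeriv_smul hz c v)
    (fun v a b => (hf.dirDeriv_left hU v).dirDeriv_add hU hx a b)
    (fun c v a => (hf.dirDeriv_left hU v).dirDeriv_smul hx c a)

theorem hessian_apply {U : Set E} (hU : IsOpen U) {f : E → F} (hf : CkOn 2 U f) {x : E}
    (hx : x ∈ U) (v a : E) :
    hessian hU hf hx v a = dirDeriv (fun z => dirDeriv f z v) x a := rfl

theorem hessian_comm {U : Set E} (hU : IsOpen U) {f : E → F} (hf : CkOn 2 U f) {x : E}
    (hx : x ∈ U) (v a : E) : hessian hU hf hx v a = hessian hU hf hx a v :=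
  hf.dirDeriv_comm hU hx v a

/-- The second derivative of the quadratic map of a symmetric bilinear map. -/
theorem dirDeriv_dirDeriv_quadratic (β : E →ₗ[ℝ] E →ₗ[ℝ] F) (hβ : ∀ v w, β v w = β w v)
    {Q : E → F} (hQ : ∀ v, Q v = β v v) (v w : E) :
    dirDeriv (fun z => dirDeriv Q z v) 0 w = (2 : ℝ) • β v w := by
  have h1 : ∀ z, dirDeriv Q z v = (2 : ℝ) • β v z := fun z => by
    refine HasDirDeriv.dirDeriv_eq ?_
    -- The difference quotient of Q equals this affine function of t exactly, so no continuity of β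
    -- is needed.
    have h : Tendsto (fun t : ℝ => (2 : ℝ) • β v z + t • β v v) (𝓝[≠] 0) (𝓝 ((2 : ℝ) • β v z)) :=
      tendsto_line _ _
    refine h.congr' ?_
    filter_upwards [self_mem_nhdsWithin] with t (ht : t ≠ 0)
    simp only [hQ, map_add, map_smul, LinearMap.add_apply, LinearMap.smul_apply, hβ z v]
    have e : β z z + t • β v z + t • (β v z + t • β v v) - β z z
        = t • ((2 : ℝ) • β v z + t • β v v) := by
      module
    rw [e, smul_smul, inv_mul_cancel₀ ht, one_smul]
  simp only [h1]
  exact (hasDirDeriv_of_linear ((2 : ℝ) • β v) 0 w).dirDeriv_eq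

/-- The derivative of `(z, w) ↦ D f (z) (w)`. -/
theorem CkOn.dirDeriv_tangent {U : Set E} (hU : IsOpen U) {f : E → F} (hf : CkOn 2 U f) {x : E}
    (hx : x ∈ U) (v a b : E) :
    HasDirDeriv (fun p : E × E => dirDeriv f p.1 p.2) (x, v) (a, b)
      (hessian hU hf hx v a + dirDeriv f x b) := by
  have hUo : IsOpen (U ×ˢ (univ : Set E)) := hU.prod isOpen_univ
  have hm : ((x, v) : E × E) ∈ U ×ˢ (univ : Set E) := ⟨hx, mem_univ _⟩
  -- The direction is split as (a, 0) + (0, b): the first moves only the base point and gives the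
  -- Hessian, the second moves only the argument, in which D f is linear.
  have h1 : HasDirDeriv (fun p : E × E => dirDeriv f p.1 p.2) (x, v) (a, 0)
      (hessian hU hf hx v a) := by
    have := (hf.dirDeriv_left hU v).hasDirDeriv hx a
    simpa [HasDirDeriv, hessian_apply] using this
  have h2 : HasDirDeriv (fun p : E × E => dirDeriv f p.1 p.2) (x, v) (0, b)
      (dirDeriv f x b) := by
    refine tendsto_const_nhds.congr' ?_
    filter_upwards [self_mem_nhdsWithin] with t (ht : t ≠ 0)
    simp [hf.of_succ.dirDeriv_add hU hx, hf.of_succ.dirDeriv_smul hx, smul_smul, ht]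
  have h3 := hf.2.2.hasDirDeriv hm ((a, 0) + (0, b))
  rw [CkOn.dirDeriv_add hUo hf.2.2 hm, h1.dirDeriv_eq, h2.dirDeriv_eq] at h3
  simpa using h3

end Hessian

/-! ### Smoothness tested in a covering family of charts. -/

section SmoothCriterion

universe v w v' w'

variable (E : Type v) [AddCommGroup E] [Module ℝ E] [TopologicalSpace E]
  [IsTopologicalAddGroup E] [ContinuousSMul ℝ E] [LocallyConvexSpace ℝ E] [T2Space E]
  (F : Type v') [AddCommGroup F] [Module ℝ F] [TopologicalSpace F]
  [IsTopologicalAddGroup F] [ContinuousSMul ℝ F] [LocallyConvexSpace ℝ F] [T2Space F]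
  {M : Type w} [TopologicalSpace M] [ChartedSpace E M]
  {N : Type w'} [TopologicalSpace N] [ChartedSpace F N]
  [HasGroupoid M (smoothGroupoid E)] [HasGroupoid N (smoothGroupoid F)]

/-- A map is smooth if it is smooth in a family of pairs of charts whose sources cover `M`. -/
theorem isSmooth_of_charts {κ : Type*} {f : M → N} (P : κ → atlas E M) (Q : κ → atlas F N)
    (hcov : ∀ x, ∃ k, x ∈ (P k).1.source)
    (hmaps : ∀ k, MapsTo f (P k).1.source (Q k).1.source)
    (hs : ∀ k, SmoothOn (P k).1.target ((Q k).1 ∘ f ∘ (P k).1.symm)) : IsSmooth E F f := by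
  have hcont : Continuous f := by
    refine continuous_iff_continuousAt.2 fun x => ?_
    obtain ⟨k, hk⟩ := hcov x
    have h1 : ContinuousOn ((Q k).1.symm ∘ ((Q k).1 ∘ f ∘ (P k).1.symm) ∘ (P k).1)
        (P k).1.source := by
      refine (Q k).1.continuousOn_symm.comp ((hs k 0).continuousOn.comp (P k).1.continuousOn
        (P k).1.mapsTo) ?_
      intro y hy
      simpa [hy] using (Q k).1.map_source (hmaps k hy)
    refine (h1.congr fun y hy => ?_).continuousAt ((P k).1.open_source.mem_nhds hk)
    simp [hy, (Q k).1.left_inv (hmaps k hy)]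
  refine ⟨hcont, fun i hi j hj n => ?_⟩
  have hoi : IsOpen (i.target ∩ i.symm ⁻¹' (f ⁻¹' j.source)) :=
    i.isOpen_inter_preimage_symm (j.open_source.preimage hcont)
  -- Near p, the expression of f in the charts i, j is its expression in the k-th pair, composed
  -- with a transition map on each side.
  refine CkOn.of_locally fun p hp => ?_
  obtain ⟨k, hk⟩ := hcov (i.symm p)
  have ho : IsOpen (i.symm ≫ₕ (P k).1).source := (i.symm ≫ₕ (P k).1).open_source
  refine ⟨_, ho, by simpa using ⟨hp.1, hk⟩, ?_⟩
  have hoi' := hoi.inter ho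
  have h1 := (smoothOn_transition E M ⟨i, hi⟩ (P k) n).mono
    (V := (i.target ∩ i.symm ⁻¹' (f ⁻¹' j.source)) ∩ (i.symm ≫ₕ (P k).1).source)
    inter_subset_right
  have h2 := CkOn.comp hoi' (P k).1.open_target (hs k n) h1 (fun q hq => by
    have : i.symm q ∈ (P k).1.source := by simpa using hq.2.2
    simpa using (P k).1.map_source this)
  have hq' : ∀ q ∈ (i.target ∩ i.symm ⁻¹' (f ⁻¹' j.source)) ∩ (i.symm ≫ₕ (P k).1).source,
      i.symm q ∈ (P k).1.source := fun q hq => by simpa using hq.2.2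
  have h3 := CkOn.comp hoi' ((Q k).1.symm ≫ₕ j).open_source
    (smoothOn_transition F N (Q k) ⟨j, hj⟩ n) h2 (fun q hq => by
      have h := hq' q hq
      have hj' : f (i.symm q) ∈ j.source := hq.1.2
      simpa [h, (Q k).1.left_inv (hmaps k h)] using ⟨(Q k).1.map_source (hmaps k h), hj'⟩)
  refine h3.congr hoi' fun q hq => ?_
  have h := hq' q hq
  simp [h, (Q k).1.left_inv (hmaps k h)]

theorem isSmooth_iff_charts {κ : Type*} {f : M → N} (P : κ → atlas E M) (Q : κ → atlas F N)
    (hcov : ∀ x, ∃ k, x ∈ (P k).1.source)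
    (hmaps : ∀ k, MapsTo f (P k).1.source (Q k).1.source) :
    IsSmooth E F f ↔ ∀ k, SmoothOn (P k).1.target ((Q k).1 ∘ f ∘ (P k).1.symm) :=
  ⟨fun h k n => (h.2 _ (P k).2 _ (Q k).2 n).mono
    fun _ hq => ⟨hq, hmaps k ((P k).1.map_target hq)⟩,
    isSmooth_of_charts E F P Q hcov hmaps⟩

end SmoothCriterion

/-! ### Coordinates on TM and T(TM), and the structures of T(TM) in the preferred chart. -/

section TangentCoordinates

universe v w

variable {F : Type v} [AddCommGroup F] [Module ℝ F] [TopologicalSpace F]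
  [IsTopologicalAddGroup F] [ContinuousSMul ℝ F] [LocallyConvexSpace ℝ F] [T2Space F]
  {M : Type w} [TopologicalSpace M] [ChartedSpace F M] [HasGroupoid M (smoothGroupoid F)]

theorem chartAt_mem_transition_source (i : atlas F M) {p : M} (hp : p ∈ i.1.source) :
    chartAt F p p ∈ ((achart F p).1.symm ≫ₕ i.1).source := by
  simpa using hp

/-- The coordinates of the tangent vectors at `p` in the chart `i`. -/
def fibreCoord (i : atlas F M) (p : M) (hp : p ∈ i.1.source) : TSpace F p ≃ₗ[ℝ] F :=
  LinearEquiv.ofBijective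
    ((derivMap ((achart F p).1.symm ≫ₕ i.1).open_source
      (smoothOn_transition F M (achart F p) i 1)
      (chartAt_mem_transition_source i hp)).comp (coord F p).toLinearMap)
    -- Bijectivity on the fibre is inherited from the chart of TM, which is injective on its source
    -- and has a right inverse on its target.
    ⟨fun v w h => by
      have hs : ∀ z : TSpace F p, (⟨p, z⟩ : TB F M) ∈ (tangentChart F i).source := fun z => by
        rw [tangentChart_source]; exact hp
      have := (tangentChart F i).injOn (hs v) (hs w) (Prod.ext rfl h)
      simpa using this,
    fun w => by
      have ht : (i.1 p, w) ∈ (tangentChart F i).target := by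
        rw [tangentChart_target]; exact ⟨i.1.map_source hp, mem_univ _⟩
      have hu := (tangentChart F i).right_inv ht
      have hpu : ((tangentChart F i).symm (i.1 p, w)).proj = p := i.1.left_inv hp
      -- The fibre depends on the base point; once the vector is a variable, its base point can be
      -- replaced by p without transport.
      generalize (tangentChart F i).symm (i.1 p, w) = z at hu hpu
      obtain ⟨q, v⟩ := z
      obtain rfl : q = p := hpu
      exact ⟨v, congrArg Prod.snd hu⟩⟩

theorem tangentChart_mk (i : atlas F M) (p : M) (hp : p ∈ i.1.source) (v : TSpace F p) :
    tangentChart F i ⟨p, v⟩ = (i.1 p, fibreCoord i p hp v) := rfl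

theorem tangentChart_symm_mk (i : atlas F M) (p : M) (hp : p ∈ i.1.source) (w : F) :
    (tangentChart F i).symm (i.1 p, w) = ⟨p, (fibreCoord i p hp).symm w⟩ := by
  have hs : (⟨p, (fibreCoord i p hp).symm w⟩ : TB F M) ∈ (tangentChart F i).source := by
    rw [tangentChart_source]; exact hp
  rw [← (tangentChart F i).left_inv hs, tangentChart_mk i p hp, LinearEquiv.apply_symm_apply]

theorem fibreCoord_achart (p : M) (v : TSpace F p) :
    fibreCoord (achart F p) p (mem_chart_source F p) v = coord F p v :=
  (tangentCore F M).coordChange_self (achart F p) p (mem_chart_source F p) _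

theorem tangentChart_achart (u : TB F M) :
    tangentChart F (achart F u.proj) u = (chartAt F u.proj u.proj, coord F u.proj u.snd) :=
  Prod.ext rfl (fibreCoord_achart u.proj u.snd)

/-- The second derivative of the transition map from the preferred chart at `p` to `i`. -/
def chartHessian (i : atlas F M) (p : M) (hp : p ∈ i.1.source) :
    TSpace F p →ₗ[ℝ] TSpace F p →ₗ[ℝ] F :=
  (hessian ((achart F p).1.symm ≫ₕ i.1).open_source (smoothOn_transition F M (achart F p) i 2)
    (chartAt_mem_transition_source i hp)).compl₁₂ (coord F p).toLinearMap (coord F p).toLinearMap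

theorem chartHessian_comm (i : atlas F M) (p : M) (hp : p ∈ i.1.source) (v a : TSpace F p) :
    chartHessian i p hp v a = chartHessian i p hp a v :=
  hessian_comm ((achart F p).1.symm ≫ₕ i.1).open_source (smoothOn_transition F M (achart F p) i 2)
    (chartAt_mem_transition_source i hp) (coord F p v) (coord F p a)

/-- The splitting `(a, b)` of a vector in `T_u(TM)`, in the preferred chart. -/
def split (u : TB F M) : TSpace (F × F) u ≃ₗ[ℝ] TSpace F u.proj × TSpace F u.proj :=
  (coord (F × F) u).trans ((coord F u.proj).symm.prodCongr (coord F u.proj).symm)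

theorem TProj_eq_split (u : TB F M) (ξ : TSpace (F × F) u) : TProj u ξ = (split u ξ).1 :=
  TProj_apply u ξ

theorem mem_vert_iff (u : TB F M) (ξ : TSpace (F × F) u) : ξ ∈ vert u ↔ (split u ξ).1 = 0 := by
  rw [← TProj_eq_split]; rfl

theorem verticalLift_eq_split (u : TB F M) (w : TSpace F u.proj) :
    verticalLift u w = (split u).symm (0, w) := by
  have h : HasDirDeriv (fun t : ℝ => chartAt (F × F) u (⟨u.proj, u.snd + t • w⟩ : TB F M)) 0 1
      ((0 : F), coord F u.proj w) := by
    have e : ∀ t : ℝ, chartAt (F × F) u (⟨u.proj, u.snd + t • w⟩ : TB F M)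
        = (chartAt F u.proj u.proj, coord F u.proj u.snd + t • coord F u.proj w) := fun t => by
      rw [← map_smul, ← map_add]
      exact tangentChart_achart ⟨u.proj, u.snd + t • w⟩
    simp only [HasDirDeriv, e]
    refine tendsto_const_nhds.congr' ?_
    filter_upwards [self_mem_nhdsWithin] with t (ht : t ≠ 0)
    simp [smul_smul, ht]
  exact congrArg (coord (F × F) u).symm h.dirDeriv_eq

theorem tangentStructure_eq_split (u : TB F M) (ξ : TSpace (F × F) u) :
    tangentStructure u ξ = (split u).symm (0, (split u ξ).1) := by
  rw [tangentStructure, verticalLift_eq_split, TProj_eq_split]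

theorem secAdd_eq_split {x : M} {v w : TSpace F x} (ξ : TSpace (F × F) (⟨x, v⟩ : TB F M))
    (η : TSpace (F × F) (⟨x, w⟩ : TB F M)) :
    secAdd ξ η = (split ⟨x, v + w⟩).symm ((split _ ξ).1, (split _ ξ).2 + (split _ η).2) := rfl

/-- `u` and `scale s u` share their base point, hence their preferred chart, and in it the scaling
is the linear map (x, v) ↦ (x, s v), which is its own derivative. -/
theorem tangentMapAt_scale (s : ℝ) (u : TB F M) (ξ : TSpace (F × F) u) :
    tangentMapAt (F × F) (F × F) (scale s) u ξ =
      (split (scale s u)).symm ((split u ξ).1, s • (split u ξ).2) := by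
  have h : (chartAt (F × F) (scale s u) ∘ scale s ∘ (chartAt (F × F) u).symm)
      =ᶠ[𝓝 (chartAt (F × F) u u)]
        (LinearMap.id : F →ₗ[ℝ] F).prodMap (s • (LinearMap.id : F →ₗ[ℝ] F)) := by
    filter_upwards [(chartAt (F × F) u).open_target.mem_nhds
      ((chartAt (F × F) u).map_source (mem_chart_source _ u))] with q hq
    have hq' : q ∈ (tangentChart F (achart F u.proj)).target := hq
    have hr := (tangentChart F (achart F u.proj)).right_inv hq'
    rw [tangentChart_target] at hq'
    have hs : ((tangentChart F (achart F u.proj)).symm q).proj ∈ (achart F u.proj).1.source :=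
      (achart F u.proj).1.map_target hq'.1
    change tangentChart F (achart F u.proj)
      (scale s ((tangentChart F (achart F u.proj)).symm q)) = _
    generalize (tangentChart F (achart F u.proj)).symm q = z at hr hs
    obtain ⟨p, v⟩ := z
    rw [tangentChart_mk _ p hs] at hr
    rw [scale, tangentChart_mk _ p hs, map_smul, ← hr]
    rfl
  exact congrArg (coord (F × F) (scale s u)).symm ((dirDeriv_congr h).trans
    (hasDirDeriv_of_linear ((LinearMap.id : F →ₗ[ℝ] F).prodMap (s • (LinearMap.id : F →ₗ[ℝ] F)))
      _ (coord (F × F) u ξ)).dirDeriv_eq)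

theorem secSmul_eq_split (s : ℝ) (u : TB F M) (ξ : TSpace (F × F) u) :
    secSmul s u ξ = (split (scale s u)).symm ((split u ξ).1, s • (split u ξ).2) :=
  tangentMapAt_scale s u ξ

theorem tangentChart₂_source (i : atlas F M) :
    (tangentChart₂ F i).source = {ξ : TTB F M | ξ.proj.proj ∈ i.1.source} := by
  ext ξ
  rw [tangentChart₂, tangentChart_source]
  change ξ.proj ∈ (tangentChart F i).source ↔ _
  rw [tangentChart_source]
  rfl

theorem tangentChart₂_target (i : atlas F M) :
    (tangentChart₂ F i).target = (i.1.target ×ˢ univ) ×ˢ univ := by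
  rw [tangentChart₂, tangentChart_target, tangentChart_target]

/-- With φ the transition from the preferred chart at p to i, the chart of TM is (z, w) ↦ (φ z,
Dφ(z) w); differentiating its second component produces the Hessian term. This term is linear in a,
so it vanishes on vertical vectors. -/
theorem tangentChart₂_mk (i : atlas F M) (p : M) (hp : p ∈ i.1.source) (v : TSpace F p)
    (ξ : TSpace (F × F) (⟨p, v⟩ : TB F M)) :
    tangentChart₂ F i ⟨⟨p, v⟩, ξ⟩ = ((i.1 p, fibreCoord i p hp v),
      (fibreCoord i p hp (split _ ξ).1,
        chartHessian i p hp v (split _ ξ).1 + fibreCoord i p hp (split _ ξ).2)) := by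
  have h0 := chartAt_mem_transition_source i hp
  have hT := smoothOn_transition F M (achart F p) i
  have ho := ((achart F p).1.symm ≫ₕ i.1).open_source
  have hx : chartAt (F × F) (⟨p, v⟩ : TB F M) ⟨p, v⟩ = (chartAt F p p, coord F p v) :=
    tangentChart_achart ⟨p, v⟩
  have h : (tangentChart F i ∘ (chartAt (F × F) (⟨p, v⟩ : TB F M)).symm)
      =ᶠ[𝓝 (chartAt F p p, coord F p v)]
      fun q : F × F => ((i.1 ∘ (achart F p).1.symm) q.1,
        dirDeriv (i.1 ∘ (achart F p).1.symm) q.1 q.2) := by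
    filter_upwards [(ho.prod isOpen_univ).mem_nhds
      (show (chartAt F p p, coord F p v) ∈ _ ×ˢ univ from ⟨h0, mem_univ _⟩)] with q hq
    exact tangentChart_symm_trans (achart F p) i q hq.1
  have h1 : HasDirDeriv (fun q : F × F => (i.1 ∘ (achart F p).1.symm) q.1)
      (chartAt F p p, coord F p v) (coord (F × F) _ ξ)
      (fibreCoord i p hp (split _ ξ).1) := (hT 1).hasDirDeriv h0 _
  have h2 := (hT 2).dirDeriv_tangent ho h0 (coord F p v) (coord (F × F) _ ξ).1
    (coord (F × F) _ ξ).2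
  have h3 := (h1.prodMk h2).dirDeriv_eq
  rw [← dirDeriv_congr h, ← hx] at h3
  exact Prod.ext rfl h3

/-- Inverts `tangentChart₂_mk`. The existential form exhibits the base point p definitionally, so
that fibre maps can be rewritten at the resulting vector. -/
theorem tangentChart₂_symm_mk (i : atlas F M) (p : M) (hp : p ∈ i.1.source) (v a b : F) :
    ∃ ξ : TSpace (F × F) (⟨p, (fibreCoord i p hp).symm v⟩ : TB F M),
      (tangentChart₂ F i).symm ((i.1 p, v), (a, b)) = ⟨⟨p, (fibreCoord i p hp).symm v⟩, ξ⟩ ∧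
      split _ ξ = ((fibreCoord i p hp).symm a, (fibreCoord i p hp).symm
        (b - chartHessian i p hp ((fibreCoord i p hp).symm v) ((fibreCoord i p hp).symm a))) := by
  refine ⟨(split _).symm ((fibreCoord i p hp).symm a, (fibreCoord i p hp).symm
        (b - chartHessian i p hp ((fibreCoord i p hp).symm v) ((fibreCoord i p hp).symm a))),
    ?_, LinearEquiv.apply_symm_apply _ _⟩
  generalize hξ : ((split (⟨p, (fibreCoord i p hp).symm v⟩ : TB F M)).symm
    ((fibreCoord i p hp).symm a, (fibreCoord i p hp).symm
        (b - chartHessian i p hp ((fibreCoord i p hp).symm v)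
          ((fibreCoord i p hp).symm a)))) = ξ
  rw [LinearEquiv.symm_apply_eq] at hξ
  have hs : (⟨⟨p, (fibreCoord i p hp).symm v⟩, ξ⟩ : TTB F M) ∈ (tangentChart₂ F i).source := by
    rw [tangentChart₂_source]; exact hp
  rw [← (tangentChart₂ F i).left_inv hs, tangentChart₂_mk i p hp, ← hξ]
  simp

end TangentCoordinates

/-! ### Connections and morphisms over Π: smoothness, projectors and kernels. -/

section Morphisms

universe v w

variable {F : Type v} [AddCommGroup F] [Module ℝ F] [TopologicalSpace F]
  [IsTopologicalAddGroup F] [ContinuousSMul ℝ F] [LocallyConvexSpace ℝ F] [T2Space F]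
  {M : Type w} [TopologicalSpace M] [ChartedSpace F M] [HasGroupoid M (smoothGroupoid F)]

theorem SmoothOn.comp_right {E : Type*} [AddCommGroup E] [Module ℝ E] [TopologicalSpace E]
    [IsTopologicalAddGroup E] [ContinuousSMul ℝ E]
    {G : Type*} [AddCommGroup G] [Module ℝ G] [TopologicalSpace G]
    [IsTopologicalAddGroup G] [ContinuousSMul ℝ G] [LocallyConvexSpace ℝ G] [T2Space G]
    {U : Set E} (hU : IsOpen U) {f : E → F} (hf : SmoothOn U f) (l : F →L[ℝ] G) :
    SmoothOn U (fun x => l (f x)) := fun k =>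
  CkOn.comp hU isOpen_univ (ckOn_clm k isOpen_univ l) (hf k) (mapsTo_univ _ _)

theorem SmoothOn.prodMk {E : Type*} [AddCommGroup E] [Module ℝ E] [TopologicalSpace E]
    [IsTopologicalAddGroup E] [ContinuousSMul ℝ E]
    {G : Type*} [AddCommGroup G] [Module ℝ G] [TopologicalSpace G]
    [IsTopologicalAddGroup G] [ContinuousSMul ℝ G] [T2Space G]
    {U : Set E} (hU : IsOpen U) {f : E → F} {g : E → G} (hf : SmoothOn U f) (hg : SmoothOn U g) :
    SmoothOn U (fun x => (f x, g x)) := fun k => (hf k).prodMk hU (hg k)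

/-- The chart of `T(TM)` induced by a chart of `M`, as a member of the atlas. -/
def atlasChart₂ (i : atlas F M) : atlas ((F × F) × (F × F)) (TTB F M) :=
  ⟨tangentChart₂ F i, mem_range_self _⟩

/-- The chart of `TM` induced by a chart of `M`, as a member of the atlas. -/
def atlasChart (i : atlas F M) : atlas (F × F) (TB F M) :=
  ⟨tangentChart F i, mem_range_self _⟩

theorem tangentChart_cover (u : TB F M) : ∃ i : atlas F M, u ∈ (atlasChart i).1.source :=
  ⟨achart F u.proj, mem_chart_source (F × F) u⟩

theorem tangentChart₂_cover (ξ : TTB F M) : ∃ i : atlas F M, ξ ∈ (atlasChart₂ i).1.source := by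
  refine ⟨achart F ξ.proj.proj, ?_⟩
  change ξ ∈ (tangentChart₂ F _).source
  rw [tangentChart₂_source]
  exact mem_chart_source F ξ.proj.proj

/-- The map preserves the base point in M, so a single chart of M serves for both source and target;
likewise in the next two criteria. -/
theorem isSmooth_projMorphism_iff
    (T : ∀ u : TB F M, TSpace (F × F) u →ₗ[ℝ] TSpace F u.proj) :
    IsSmooth ((F × F) × (F × F)) (F × F)
      (fun ξ : TTB F M => (⟨ξ.proj.proj, T ξ.proj ξ.snd⟩ : TB F M)) ↔
    ∀ i : atlas F M, SmoothOn (tangentChart₂ F i).target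
      (tangentChart F i ∘ (fun ξ : TTB F M => (⟨ξ.proj.proj, T ξ.proj ξ.snd⟩ : TB F M)) ∘
        (tangentChart₂ F i).symm) :=
  isSmooth_iff_charts _ _ (atlasChart₂ (F := F) (M := M)) atlasChart tangentChart₂_cover
    fun i ξ hξ => by
      change _ ∈ (tangentChart F i).source
      change ξ ∈ (tangentChart₂ F i).source at hξ
      rw [tangentChart₂_source] at hξ
      rw [tangentChart_source]
      exact hξ

theorem isSmooth_bundleEndo_iff
    (T : ∀ u : TB F M, TSpace (F × F) u →ₗ[ℝ] TSpace (F × F) u) :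
    IsSmooth ((F × F) × (F × F)) ((F × F) × (F × F))
      (fun ξ : TTB F M => (⟨ξ.proj, T ξ.proj ξ.snd⟩ : TTB F M)) ↔
    ∀ i : atlas F M, SmoothOn (tangentChart₂ F i).target
      (tangentChart₂ F i ∘ (fun ξ : TTB F M => (⟨ξ.proj, T ξ.proj ξ.snd⟩ : TTB F M)) ∘
        (tangentChart₂ F i).symm) :=
  isSmooth_iff_charts _ _ (atlasChart₂ (F := F) (M := M)) atlasChart₂ tangentChart₂_cover
    fun i ξ hξ => by
      change _ ∈ (tangentChart₂ F i).source
      change ξ ∈ (tangentChart₂ F i).source at hξ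
      rw [tangentChart₂_source] at hξ ⊢
      exact hξ

theorem isSmooth_vectorField_iff (S : ∀ u : TB F M, TSpace (F × F) u) :
    IsSmooth (F × F) ((F × F) × (F × F)) (fun u : TB F M => (⟨u, S u⟩ : TTB F M)) ↔
    ∀ i : atlas F M, SmoothOn (tangentChart F i).target
      (tangentChart₂ F i ∘ (fun u : TB F M => (⟨u, S u⟩ : TTB F M)) ∘
        (tangentChart F i).symm) :=
  isSmooth_iff_charts _ _ (atlasChart (F := F) (M := M)) atlasChart₂ tangentChart_cover
    fun i u hu => by
      change _ ∈ (tangentChart₂ F i).source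
      change u ∈ (tangentChart F i).source at hu
      rw [tangentChart_source] at hu
      rw [tangentChart₂_source]
      exact hu

/-- The vertical lift of a morphism over `Π`, as an endomorphism of `T(TM)`. -/
def verticalMorphism (T : ∀ u : TB F M, TSpace (F × F) u →ₗ[ℝ] TSpace F u.proj) (u : TB F M) :
    TSpace (F × F) u →ₗ[ℝ] TSpace (F × F) u :=
  (split u).symm.toLinearMap.comp ((LinearMap.inr ℝ _ _).comp (T u))

theorem verticalMorphism_apply (T : ∀ u : TB F M, TSpace (F × F) u →ₗ[ℝ] TSpace F u.proj)
    (u : TB F M) (ξ : TSpace (F × F) u) :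
    verticalMorphism T u ξ = (split u).symm (0, T u ξ) := rfl

/-- A vertical vector has a = 0, so the Hessian term is absent in every chart: the vertical lift
reads (x, v, 0, b') where the morphism reads (x, b'). Each local form is obtained from the other by
inserting or forgetting coordinates. -/
theorem isSmooth_verticalMorphism_iff
    (T : ∀ u : TB F M, TSpace (F × F) u →ₗ[ℝ] TSpace F u.proj) :
    IsSmooth ((F × F) × (F × F)) ((F × F) × (F × F))
      (fun ξ : TTB F M => (⟨ξ.proj, verticalMorphism T ξ.proj ξ.snd⟩ : TTB F M)) ↔
    IsSmooth ((F × F) × (F × F)) (F × F)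
      (fun ξ : TTB F M => (⟨ξ.proj.proj, T ξ.proj ξ.snd⟩ : TB F M)) := by
  rw [isSmooth_bundleEndo_iff, isSmooth_projMorphism_iff]
  have key : ∀ (i : atlas F M), ∀ q ∈ (tangentChart₂ F i).target,
      (tangentChart₂ F i ∘ (fun ξ : TTB F M =>
        (⟨ξ.proj, verticalMorphism T ξ.proj ξ.snd⟩ : TTB F M)) ∘ (tangentChart₂ F i).symm) q =
      (q.1, (0, ((tangentChart F i ∘ (fun ξ : TTB F M =>
        (⟨ξ.proj.proj, T ξ.proj ξ.snd⟩ : TB F M)) ∘ (tangentChart₂ F i).symm) q).2)) ∧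
      q.1.1 = ((tangentChart F i ∘ (fun ξ : TTB F M =>
        (⟨ξ.proj.proj, T ξ.proj ξ.snd⟩ : TB F M)) ∘ (tangentChart₂ F i).symm) q).1 := by
    intro i q hq
    have hr := (tangentChart₂ F i).right_inv hq
    have hs := (tangentChart₂ F i).map_target hq
    simp only [Function.comp]
    generalize (tangentChart₂ F i).symm q = z at hr hs
    rw [tangentChart₂_source] at hs
    obtain ⟨⟨p, v⟩, ξ⟩ := z
    have hp : p ∈ i.1.source := hs
    rw [tangentChart₂_mk i p hp] at hr ⊢
    rw [tangentChart_mk i p hp, ← hr]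
    simp [verticalMorphism_apply]
  have ho : ∀ i : atlas F M, IsOpen (tangentChart₂ F i).target := fun i =>
    (tangentChart₂ F i).open_target
  refine forall_congr' fun i => ⟨fun h k => ?_, fun h k => ?_⟩
  · refine CkOn.congr (ho i) (SmoothOn.comp_right (ho i) h
      (((ContinuousLinearMap.fst ℝ F F).comp (ContinuousLinearMap.fst ℝ (F × F) (F × F))).prod
        ((ContinuousLinearMap.snd ℝ F F).comp (ContinuousLinearMap.snd ℝ (F × F) (F × F)))) k)
      fun q hq => ?_
    rw [(key i q hq).1]
    exact Prod.ext (key i q hq).2.symm rfl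
  · refine CkOn.congr (ho i) (SmoothOn.prodMk (ho i)
      (fun k => ckOn_clm k (ho i) (ContinuousLinearMap.fst ℝ (F × F) (F × F)))
      (SmoothOn.prodMk (ho i) (fun k => ckOn_const k (ho i) (0 : F))
        (SmoothOn.comp_right (ho i) h (ContinuousLinearMap.snd ℝ F F))) k) fun q hq => ?_
    rw [(key i q hq).1]
    rfl

namespace ProjMorphism

variable (K : ProjMorphism F M)

/-- Since J(w, 0) = (0, w), the condition K ∘ J = TΠ says that K_u is a left inverse of the vertical
lift. -/
theorem apply_eq (hK : ∀ u ξ, K.toFun u (tangentStructure u ξ) = TProj u ξ) (u : TB F M)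
    (w : TSpace F u.proj) : K.toFun u ((split u).symm (0, w)) = w := by
  have h := hK u ((split u).symm (w, 0))
  rwa [tangentStructure_eq_split, TProj_eq_split, LinearEquiv.apply_symm_apply] at h

/-- The connection with horizontal spaces `ker K_u`. -/
def toConnection (hK : ∀ u ξ, K.toFun u (tangentStructure u ξ) = TProj u ξ) :
    Connection F M where
  toFun := verticalMorphism K.toFun
  mem_vert u ξ := by simp [mem_vert_iff, verticalMorphism_apply]
  eq_self u ξ hξ := by
    rw [mem_vert_iff] at hξ
    have e : ξ = (split u).symm (0, (split u ξ).2) := by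
      rw [LinearEquiv.eq_symm_apply]
      exact Prod.ext hξ rfl
    rw [verticalMorphism_apply, e, K.apply_eq hK]
  smooth := (isSmooth_verticalMorphism_iff K.toFun).2 K.smooth

theorem hor_toConnection (hK : ∀ u ξ, K.toFun u (tangentStructure u ξ) = TProj u ξ)
    (u : TB F M) : (K.toConnection hK).hor u = LinearMap.ker (K.toFun u) := by
  ext ξ
  change verticalMorphism K.toFun u ξ = 0 ↔ K.toFun u ξ = 0
  rw [verticalMorphism_apply, LinearEquiv.map_eq_zero_iff, Prod.mk_eq_zero]
  simp

/-- The connection Ver ∘ K is a projector onto V_u with kernel ker K_u, and a projector splits the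
space by ξ = (ξ - Cξ) + Cξ. -/
theorem isCompl_ker_vert (hK : ∀ u ξ, K.toFun u (tangentStructure u ξ) = TProj u ξ)
    (u : TB F M) : IsCompl (LinearMap.ker (K.toFun u)) (vert u) := by
  refine IsCompl.of_eq ?_ ?_
  · rw [Submodule.eq_bot_iff]
    rintro ξ ⟨h1, h2⟩
    have h3 := (K.toConnection hK).eq_self u ξ h2
    rw [← K.hor_toConnection hK] at h1
    exact h3.symm.trans h1
  · rw [Submodule.eq_top_iff']
    intro ξ
    have h2 := (K.toConnection hK).mem_vert u ξ
    rw [← K.hor_toConnection hK, ← sub_add_cancel ξ ((K.toConnection hK).toFun u ξ)]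
    refine Submodule.add_mem_sup ?_ h2
    change (K.toConnection hK).toFun u _ = 0
    rw [map_sub, (K.toConnection hK).eq_self u _ h2, sub_self]

end ProjMorphism

namespace Connection

variable (C : Connection F M)

/-- A projector is determined by its image, here V_u for both, and its kernel. -/
theorem ext_of_hor {C C' : Connection F M} (h : ∀ u, C.hor u = C'.hor u) : C = C' := by
  have : C.toFun = C'.toFun := by
    funext u
    ext ξ : 1
    have h1 : ξ - C.toFun u ξ ∈ C.hor u := by
      change C.toFun u _ = 0
      rw [map_sub, C.eq_self u _ (C.mem_vert u ξ), sub_self]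
    rw [h u] at h1
    have h2 : C'.toFun u (ξ - C.toFun u ξ) = 0 := h1
    rw [map_sub, C'.eq_self u _ (C.mem_vert u ξ), sub_eq_zero] at h2
    exact h2.symm
  cases C
  cases C'
  cases this
  rfl

/-- The vertical part of the connection, as a fibrewise linear map `T_u(TM) → T_{Π u} M`. -/
def verticalPart (u : TB F M) : TSpace (F × F) u →ₗ[ℝ] TSpace F u.proj :=
  (LinearMap.snd ℝ _ _).comp ((split u).toLinearMap.comp (C.toFun u))

theorem verticalMorphism_verticalPart : verticalMorphism C.verticalPart = C.toFun := by
  funext u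
  ext ξ : 1
  rw [verticalMorphism_apply, LinearEquiv.symm_apply_eq]
  exact Prod.ext ((mem_vert_iff u _).1 (C.mem_vert u ξ)).symm rfl

theorem toFun_apply (u : TB F M) (ξ : TSpace (F × F) u) :
    C.toFun u ξ = (split u).symm (0, C.verticalPart u ξ) := by
  rw [← verticalMorphism_verticalPart, verticalMorphism_apply]

/-- The morphism `T(TM) → TM` determined by a connection. -/
def toProjMorphism : ProjMorphism F M where
  toFun := C.verticalPart
  smooth := by
    rw [← isSmooth_verticalMorphism_iff, verticalMorphism_verticalPart]
    exact C.smooth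

theorem verticalPart_vertical (u : TB F M) (w : TSpace F u.proj) :
    C.verticalPart u ((split u).symm (0, w)) = w := by
  have h : (split u).symm (0, w) ∈ vert u := by simp [mem_vert_iff]
  have h2 := C.eq_self u _ h
  rw [toFun_apply] at h2
  simpa using h2

theorem verticalPart_tangentStructure (u : TB F M) (ξ : TSpace (F × F) u) :
    C.verticalPart u (tangentStructure u ξ) = TProj u ξ := by
  rw [tangentStructure_eq_split, verticalPart_vertical, TProj_eq_split]

theorem mem_hor_iff (u : TB F M) (ξ : TSpace (F × F) u) :
    ξ ∈ C.hor u ↔ C.verticalPart u ξ = 0 := by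
  change C.toFun u ξ = 0 ↔ _
  rw [toFun_apply, LinearEquiv.map_eq_zero_iff, Prod.mk_eq_zero]
  simp

theorem ker_verticalPart (u : TB F M) : LinearMap.ker (C.verticalPart u) = C.hor u := by
  ext ξ
  exact (C.mem_hor_iff u ξ).symm

/-- J_u has kernel and image V_u, and H_u is a complement of V_u. -/
theorem bijOn_tangentStructure (u : TB F M) :
    BijOn (tangentStructure u) (C.hor u) (vert u) := by
  refine ⟨fun ξ _ => ?_, fun ξ hξ η hη h => ?_, fun ξ hξ => ?_⟩
  · simp [mem_vert_iff, tangentStructure_eq_split]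
  · have h1 : (split u ξ).1 = (split u η).1 := by
      simpa [tangentStructure_eq_split] using h
    have h2 : ξ - η ∈ vert u := by
      rw [mem_vert_iff, map_sub, Prod.fst_sub, h1, sub_self]
    have h3 : C.toFun u (ξ - η) = 0 := (C.hor u).sub_mem hξ hη
    rw [C.eq_self u _ h2] at h3
    exact sub_eq_zero.1 h3
  · have h1 : (split u ξ).1 = 0 := (mem_vert_iff u ξ).1 hξ
    -- For ξ = (0, w), J sends (w, 0) to ξ; subtracting the vertical part makes the preimage
    -- horizontal and is invisible to J.
    refine ⟨(split u).symm ((split u ξ).2, 0) -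
      C.toFun u ((split u).symm ((split u ξ).2, 0)), ?_, ?_⟩
    · change C.toFun u _ = 0
      rw [map_sub, C.eq_self u _ (C.mem_vert u _), sub_self]
    · rw [tangentStructure_eq_split, toFun_apply, LinearEquiv.symm_apply_eq]
      refine Prod.ext h1.symm ?_
      simp

/-- By the choice of L, J(Lξ) = Cξ; both sides are vertical lifts, of TΠ(Lξ) and of the vertical
part of ξ, and the lift is injective. -/
theorem TProj_L (u : TB F M) (ξ : TSpace (F × F) u) :
    TProj u (C.L u ξ) = C.verticalPart u ξ := by
  have h := Function.invFunOn_eq ((C.bijOn_tangentStructure u).surjOn (C.mem_vert u ξ))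
  change tangentStructure u (C.L u ξ) = _ at h
  rw [tangentStructure_eq_split, toFun_apply] at h
  rw [TProj_eq_split]
  simpa using h

end Connection

end Morphisms

/-! ### Christoffel symbols, sprays and connection maps. -/

section ConnectionMaps

universe v w

variable {F : Type v} [AddCommGroup F] [Module ℝ F] [TopologicalSpace F]
  [IsTopologicalAddGroup F] [ContinuousSMul ℝ F] [LocallyConvexSpace ℝ F] [T2Space F]
  {M : Type w} [TopologicalSpace M] [ChartedSpace F M] [HasGroupoid M (smoothGroupoid F)]

namespace ProjMorphism

/-- The morphism `K` is `(a, b) ↦ b - Γ_p(v, a)` on `T_{(p, v)}(TM)`, in the preferred charts, for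
a family `Γ` of symmetric bilinear maps. -/
def HasChristoffel (K : ProjMorphism F M)
    (Γ : ∀ p : M, TSpace F p →ₗ[ℝ] TSpace F p →ₗ[ℝ] TSpace F p) : Prop :=
  (∀ p v a, Γ p v a = Γ p a v) ∧
  ∀ (u : TB F M) (ξ : TSpace (F × F) u),
    K.toFun u ξ = (split u ξ).2 - Γ u.proj u.snd (split u ξ).1

/-- The symmetric bilinear map of the chart `i`. -/
def chartChristoffel (Γ : ∀ p : M, TSpace F p →ₗ[ℝ] TSpace F p →ₗ[ℝ] TSpace F p)
    (i : atlas F M) (p : M) (hp : p ∈ i.1.source) : F →ₗ[ℝ] F →ₗ[ℝ] F :=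
  (chartHessian i p hp + (Γ p).compr₂ (fibreCoord i p hp).toLinearMap).compl₁₂
    (fibreCoord i p hp).symm.toLinearMap (fibreCoord i p hp).symm.toLinearMap

theorem chartChristoffel_apply (Γ : ∀ p : M, TSpace F p →ₗ[ℝ] TSpace F p →ₗ[ℝ] TSpace F p)
    (i : atlas F M) (p : M) (hp : p ∈ i.1.source) (v a : F) :
    chartChristoffel Γ i p hp v a =
      chartHessian i p hp ((fibreCoord i p hp).symm v) ((fibreCoord i p hp).symm a) +
        fibreCoord i p hp (Γ p ((fibreCoord i p hp).symm v) ((fibreCoord i p hp).symm a)) := rfl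

variable {K : ProjMorphism F M}
  {Γ : ∀ p : M, TSpace F p →ₗ[ℝ] TSpace F p →ₗ[ℝ] TSpace F p}

/-- The transformation law of Christoffel symbols: the Hessian by which the last coordinate of T(TM)
shifts under the change of charts is absorbed into Γ. -/
theorem HasChristoffel.chart_apply (h : K.HasChristoffel Γ) (i : atlas F M) (p : M)
    (hp : p ∈ i.1.source) (v a b : F) :
    tangentChart F i
      ⟨((tangentChart₂ F i).symm ((i.1 p, v), (a, b))).proj.proj,
        K.toFun _ ((tangentChart₂ F i).symm ((i.1 p, v), (a, b))).snd⟩ =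
      (i.1 p, b - chartChristoffel Γ i p hp v a) := by
  obtain ⟨ξ, h1, h2⟩ := tangentChart₂_symm_mk i p hp v a b
  rw [h1, tangentChart_mk i p hp, h.2, h2, chartChristoffel_apply]
  simp only [map_sub, LinearEquiv.apply_symm_apply]
  rw [sub_sub]

/-- The spray `S(u) = (v, Γ(v, v))`. -/
def HasChristoffel.spray (h : K.HasChristoffel Γ) : Spray F M where
  toFun u := (split u).symm (u.snd, Γ u.proj u.snd u.snd)
  smooth := by
    rw [isSmooth_vectorField_iff]
    intro i
    have ho := (tangentChart F i).open_target
    have hm : MapsTo (fun q : F × F => (q, (q.2, (0 : F)))) (tangentChart F i).target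
        (tangentChart₂ F i).target := fun q hq => by
      rw [tangentChart_target] at hq
      rw [tangentChart₂_target]
      exact ⟨hq, mem_univ _⟩
    -- In a chart S_i(x, v) = -K(x, v, v, 0), so the smoothness of S comes from K; `HasChristoffel`
    -- requires no regularity of Γ in p.
    have h1 : SmoothOn (tangentChart F i).target (fun q : F × F =>
        (tangentChart F i ∘ (fun ξ : TTB F M => (⟨ξ.proj.proj, K.toFun ξ.proj ξ.snd⟩ : TB F M)) ∘
          (tangentChart₂ F i).symm) (q, (q.2, (0 : F)))) := fun k =>
      CkOn.comp_clm ho ((isSmooth_projMorphism_iff K.toFun).1 K.smooth i k)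
        ((ContinuousLinearMap.id ℝ (F × F)).prod
          ((ContinuousLinearMap.snd ℝ F F).prod 0)) hm
    have h2 := SmoothOn.prodMk ho
      (fun k => ckOn_clm k ho (ContinuousLinearMap.id ℝ (F × F)))
      (SmoothOn.prodMk ho (fun k => ckOn_clm k ho (ContinuousLinearMap.snd ℝ F F))
        (SmoothOn.comp_right ho h1 (-ContinuousLinearMap.snd ℝ F F)))
    intro k
    refine (h2 k).congr ho fun q hq => ?_
    rw [tangentChart_target] at hq
    obtain ⟨x, v⟩ := q
    obtain ⟨p, hp, rfl⟩ : ∃ p ∈ i.1.source, i.1 p = x :=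
      ⟨_, i.1.map_target hq.1, i.1.right_inv hq.1⟩
    have h3 := h.chart_apply i p hp v v 0
    simp only [Function.comp]
    rw [h3, tangentChart_symm_mk i p hp, tangentChart₂_mk i p hp]
    simp [chartChristoffel_apply]
  second_order u := by
    rw [TProj_eq_split, LinearEquiv.apply_symm_apply]
  homogeneous s u := by
    rw [tangentMapAt_scale, map_smul, LinearEquiv.apply_symm_apply]
    obtain ⟨p, v⟩ := u
    refine congrArg (split (⟨p, s • v⟩ : TB F M)).symm (Prod.ext rfl ?_)
    change Γ p (s • v) (s • v) = s • s • Γ p v v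
    rw [map_smul, map_smul, LinearMap.smul_apply]

theorem HasChristoffel.spray_localRep (h : K.HasChristoffel Γ) (i : atlas F M) (p : M)
    (hp : p ∈ i.1.source) (v : F) :
    h.spray.localRep i (i.1 p) v = chartChristoffel Γ i p hp v v := by
  rw [Spray.localRep, tangentChart_symm_mk i p hp, tangentChart₂_mk i p hp]
  simp [HasChristoffel.spray, chartChristoffel_apply]

/-- In each chart the spray is the diagonal of `chartChristoffel`, and half the second derivative of
a quadratic map is its symmetric bilinear form. The symmetry in an arbitrary chart rests on Schwarz'
theorem for the transition map. -/
theorem HasChristoffel.isConnectionMap (h : K.HasChristoffel Γ) : K.IsConnectionMap := by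
  refine ⟨h.spray, fun i x hx v a b => ?_⟩
  obtain ⟨p, hp, rfl⟩ : ∃ p ∈ i.1.source, i.1 p = x :=
    ⟨_, i.1.map_target hx, i.1.right_inv hx⟩
  have hs : ∀ v a, chartChristoffel Γ i p hp v a = chartChristoffel Γ i p hp a v := fun v a => by
    rw [chartChristoffel_apply, chartChristoffel_apply, chartHessian_comm, h.1]
  rw [h.chart_apply i p hp, Spray.bilin,
    dirDeriv_dirDeriv_quadratic _ hs (h.spray_localRep i p hp), smul_smul]
  norm_num

theorem HasChristoffel.apply_tangentStructure (h : K.HasChristoffel Γ) (u : TB F M)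
    (ξ : TSpace (F × F) u) : K.toFun u (tangentStructure u ξ) = TProj u ξ := by
  rw [h.2, tangentStructure_eq_split, LinearEquiv.apply_symm_apply, TProj_eq_split]
  simp

/-- For fixed a, the expression b - Γ(v, a) is linear in (v, b), the fibre variable of the secondary
structure. -/
theorem HasChristoffel.verticalPart_isLinear (h : K.HasChristoffel Γ) {C : Connection F M}
    (hC : C.verticalPart = K.toFun) : C.IsLinear := by
  refine ⟨fun x v w ξ η hξη => ?_, fun s u ξ => ?_⟩
  · rw [TProj_eq_split, TProj_eq_split] at hξη
    have h1 : (split (⟨x, v⟩ : TB F M) ξ).1 = (split (⟨x, w⟩ : TB F M) η).1 := hξη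
    simp only [C.toFun_apply, hC, h.2, secAdd_eq_split, LinearEquiv.apply_symm_apply, map_add,
      LinearMap.add_apply]
    rw [h1]
    congr 2
    abel
  · simp only [C.toFun_apply, hC, h.2, secSmul_eq_split, LinearEquiv.apply_symm_apply]
    obtain ⟨p, v⟩ := u
    refine congrArg (split (⟨p, s • v⟩ : TB F M)).symm (Prod.ext rfl ?_)
    change s • (split _ ξ).2 - Γ p (s • v) (split _ ξ).1 =
      s • ((split _ ξ).2 - Γ p v (split _ ξ).1)
    rw [map_smul, LinearMap.smul_apply, smul_sub]

/-- The involution exchanges v and a and fixes b, so b - Γ(v, a) is unchanged. -/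
theorem HasChristoffel.verticalPart_isSymmetric (h : K.HasChristoffel Γ) {C : Connection F M}
    (hC : C.verticalPart = K.toFun) : C.IsSymmetric := by
  rintro ξ w hw
  rw [C.toFun_apply, hC, verticalLift_eq_split] at hw
  have h1 : K.toFun ξ.proj ξ.snd = w := by simpa using hw
  refine (C.toFun_apply _ _).trans (Eq.trans ?_ (verticalLift_eq_split _ _).symm)
  refine congrArg (split (involution ξ).proj).symm (Prod.ext rfl ?_)
  change C.verticalPart (involution ξ).proj (involution ξ).snd = w
  rw [hC, h.2, ← h1, h.2, h.1 _ ξ.proj.snd]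
  rfl

/-- A connection map is given by Christoffel symbols. -/
theorem IsConnectionMap.exists_hasChristoffel (hK : K.IsConnectionMap) :
    ∃ Γ : ∀ p : M, TSpace F p →ₗ[ℝ] TSpace F p →ₗ[ℝ] TSpace F p, K.HasChristoffel Γ := by
  obtain ⟨S, hS⟩ := hK
  have hsm : ∀ p : M, CkOn 2 univ (S.localRep (achart F p) (chartAt F p p)) := fun p => by
    have h1 := (isSmooth_vectorField_iff S.toFun).1 S.smooth (achart F p)
    have h2 := SmoothOn.comp_right (tangentChart F (achart F p)).open_target h1
      ((ContinuousLinearMap.snd ℝ F F).comp (ContinuousLinearMap.snd ℝ (F × F) (F × F))) 2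
    refine CkOn.comp (f := fun v : F => (chartAt F p p, v)) isOpen_univ
      (tangentChart F (achart F p)).open_target h2
      ((ckOn_const 2 isOpen_univ _).prodMk isOpen_univ
        (ckOn_clm 2 isOpen_univ (ContinuousLinearMap.id ℝ F))) fun v _ => ?_
    rw [tangentChart_target]
    exact ⟨mem_chart_target F p, mem_univ _⟩
  -- Γ_p is B of the preferred chart at p, evaluated at p itself; Schwarz' theorem makes it
  -- symmetric.
  refine ⟨fun p => (2 : ℝ)⁻¹ • ((hessian isOpen_univ (hsm p) (mem_univ 0)).compl₁₂
    (coord F p).toLinearMap (coord F p).toLinearMap).compr₂ (coord F p).symm.toLinearMap,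
    fun p v a => ?_, fun u ξ => ?_⟩
  · exact congrArg (fun z => (2 : ℝ)⁻¹ • (coord F p).symm z)
      (hessian_comm isOpen_univ (hsm p) (mem_univ 0) (coord F p v) (coord F p a))
  -- At its own base point the preferred chart gives exactly the coordinates in which tangent
  -- vectors are stored, so the local formula for K is already the normal form.
  · have e : tangentChart₂ F (achart F u.proj) (⟨u, ξ⟩ : TTB F M) =
        ((chartAt F u.proj u.proj, coord F u.proj u.snd), coord (F × F) u ξ) :=
      (tangentChart_achart (F := F × F) (⟨u, ξ⟩ : TTB F M)).trans
        (Prod.ext (tangentChart_achart u) rfl)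
    have hs : (⟨u, ξ⟩ : TTB F M) ∈ (tangentChart₂ F (achart F u.proj)).source := by
      rw [tangentChart₂_source]
      exact mem_chart_source F u.proj
    have h1 := hS (achart F u.proj) (chartAt F u.proj u.proj) (mem_chart_target F u.proj)
      (coord F u.proj u.snd) (coord (F × F) u ξ).1 (coord (F × F) u ξ).2
    have e2 := (tangentChart₂ F (achart F u.proj)).left_inv hs
    rw [e] at e2
    rw [show (((chartAt F u.proj u.proj, coord F u.proj u.snd),
      ((coord (F × F) u ξ).1, (coord (F × F) u ξ).2)) : (F × F) × (F × F)) =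
        ((chartAt F u.proj u.proj, coord F u.proj u.snd), coord (F × F) u ξ) from rfl, e2] at h1
    have h3 := (tangentChart_achart (⟨u.proj, K.toFun u ξ⟩ : TB F M)).symm.trans h1
    have h4 := congrArg (fun z : F × F => (coord F u.proj).symm z.2) h3
    exact h4

end ProjMorphism

namespace Connection

variable (C : Connection F M)

/-- The vertical part of (a, 0) over v will be -Γ(v, a). This lemma and the next two translate the
secondary linearity and the symmetry of C into properties of Γ. -/
theorem verticalPart_add (hl : C.IsLinear) (p : M) (v w a : TSpace F p) :
    C.verticalPart ⟨p, v + w⟩ ((split (⟨p, v + w⟩ : TB F M)).symm (a, 0)) =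
      C.verticalPart ⟨p, v⟩ ((split (⟨p, v⟩ : TB F M)).symm (a, 0)) +
        C.verticalPart ⟨p, w⟩ ((split (⟨p, w⟩ : TB F M)).symm (a, 0)) := by
  have h := hl.1 p v w ((split (⟨p, v⟩ : TB F M)).symm (a, 0))
    ((split (⟨p, w⟩ : TB F M)).symm (a, 0)) (by
      rw [TProj_eq_split, TProj_eq_split, LinearEquiv.apply_symm_apply,
        LinearEquiv.apply_symm_apply])
  simpa [C.toFun_apply, secAdd_eq_split] using h

theorem verticalPart_smul (hl : C.IsLinear) (p : M) (s : ℝ) (v a : TSpace F p) :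
    C.verticalPart ⟨p, s • v⟩ ((split (⟨p, s • v⟩ : TB F M)).symm (a, 0)) =
      s • C.verticalPart ⟨p, v⟩ ((split (⟨p, v⟩ : TB F M)).symm (a, 0)) := by
  have h := hl.2 s ⟨p, v⟩ ((split (⟨p, v⟩ : TB F M)).symm (a, 0))
  rw [secSmul_eq_split, secSmul_eq_split, LinearEquiv.apply_symm_apply, smul_zero,
    C.toFun_apply ⟨p, v⟩, LinearEquiv.apply_symm_apply] at h
  exact congrArg (fun z => (split (⟨p, s • v⟩ : TB F M) z).2) h

theorem verticalPart_comm (hs : C.IsSymmetric) (p : M) (v a : TSpace F p) :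
    C.verticalPart ⟨p, v⟩ ((split (⟨p, v⟩ : TB F M)).symm (a, 0)) =
      C.verticalPart ⟨p, a⟩ ((split (⟨p, a⟩ : TB F M)).symm (v, 0)) := by
  have h := hs ⟨⟨p, v⟩, (split (⟨p, v⟩ : TB F M)).symm (a, 0)⟩
    (C.verticalPart ⟨p, v⟩ ((split (⟨p, v⟩ : TB F M)).symm (a, 0)))
    (by rw [verticalLift_eq_split, C.toFun_apply])
  exact (congrArg (fun z => (split (⟨p, a⟩ : TB F M) z).2)
    (h.trans (verticalLift_eq_split _ _))).symm

end Connection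

/-- A linear symmetric connection is given by Christoffel symbols. -/
theorem Connection.exists_hasChristoffel (C : Connection F M) (hl : C.IsLinear)
    (hs : C.IsSymmetric) :
    ∃ Γ : ∀ p : M, TSpace F p →ₗ[ℝ] TSpace F p →ₗ[ℝ] TSpace F p,
      C.toProjMorphism.HasChristoffel Γ := by
  refine ⟨fun p => LinearMap.mk₂ ℝ
    -- Forced by the normal form at b = 0. Linearity in v is that of the secondary structure;
    -- linearity in a is that of C on T_u(TM).
    (fun v a => -C.verticalPart ⟨p, v⟩ ((split (⟨p, v⟩ : TB F M)).symm (a, 0)))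
    (fun v w a => by rw [C.verticalPart_add hl, neg_add])
    (fun s v a => by rw [C.verticalPart_smul hl, smul_neg])
    (fun v a b => by
      rw [← neg_add, ← map_add, ← map_add, Prod.mk_add_mk, add_zero])
    (fun s v a => by
      rw [smul_neg, ← map_smul, ← map_smul, Prod.smul_mk, smul_zero]), fun p v a => congrArg Neg.neg (C.verticalPart_comm hs p v a), fun u ξ => ?_⟩
  have e : ξ = (split u).symm ((split u ξ).1, 0) + (split u).symm (0, (split u ξ).2) := by
    rw [← map_add, LinearEquiv.eq_symm_apply]
    simp
  change C.verticalPart u ξ = _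
  conv_lhs => rw [e, map_add, C.verticalPart_vertical]
  rw [LinearMap.mk₂_apply, sub_neg_eq_add, add_comm]

end ConnectionMaps

end FrechetGeom

end

/-! ### The correspondence between linear symmetric connections and connection maps. -/

theorem mainTheorem5
    {F : Type*} [AddCommGroup F] [Module ℝ F] [TopologicalSpace F]
    [IsTopologicalAddGroup F] [ContinuousSMul ℝ F] [LocallyConvexSpace ℝ F]
    [TopologicalSpace.IsCompletelyMetrizableSpace F]
    {M : Type*} [TopologicalSpace M] [ChartedSpace F M]
    [HasGroupoid M (FrechetGeom.smoothGroupoid F)] :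
    -- a linear symmetric connection determines a connection map
    (∀ C : FrechetGeom.Connection F M, C.IsLinear → C.IsSymmetric →
      (∀ u : FrechetGeom.TB F M,
        Set.BijOn (FrechetGeom.tangentStructure u) (C.hor u) (FrechetGeom.vert u)) ∧
      ∃ K : FrechetGeom.ProjMorphism F M, K.IsConnectionMap ∧
        (∀ u ξ, K.toFun u ξ = FrechetGeom.TProj u (C.L u ξ)) ∧
        (∀ u ξ, K.toFun u (FrechetGeom.tangentStructure u ξ) = FrechetGeom.TProj u ξ) ∧
        (∀ u, LinearMap.ker (K.toFun u) = C.hor u)) ∧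
    -- a vector bundle morphism `K` with `K ∘ J = TΠ` determines a connection
    (∀ K : FrechetGeom.ProjMorphism F M,
      (∀ u ξ, K.toFun u (FrechetGeom.tangentStructure u ξ) = FrechetGeom.TProj u ξ) →
      (∀ u, IsCompl (LinearMap.ker (K.toFun u)) (FrechetGeom.vert u)) ∧
      ∃! C : FrechetGeom.Connection F M, ∀ u, C.hor u = LinearMap.ker (K.toFun u)) ∧
    -- a connection map determines a linear symmetric connection, inversely to the first part
    (∀ K : FrechetGeom.ProjMorphism F M, K.IsConnectionMap →
      (∀ u ξ, K.toFun u (FrechetGeom.tangentStructure u ξ) = FrechetGeom.TProj u ξ) ∧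
      (∀ u, IsCompl (LinearMap.ker (K.toFun u)) (FrechetGeom.vert u)) ∧
      ∃! C : FrechetGeom.Connection F M, C.IsLinear ∧ C.IsSymmetric ∧
        (∀ u, C.hor u = LinearMap.ker (K.toFun u)) ∧
        (∀ u ξ, K.toFun u ξ = FrechetGeom.TProj u (C.L u ξ))) := by
  refine ⟨fun C hl hs => ?_, fun K hK => ?_, fun K hK => ?_⟩
  · obtain ⟨Γ, hΓ⟩ := C.exists_hasChristoffel hl hs
    exact ⟨C.bijOn_tangentStructure, C.toProjMorphism, hΓ.isConnectionMap,
      fun u ξ => (C.TProj_L u ξ).symm, C.verticalPart_tangentStructure, C.ker_verticalPart⟩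
  · exact ⟨K.isCompl_ker_vert hK, K.toConnection hK, K.hor_toConnection hK,
      fun C hC => FrechetGeom.Connection.ext_of_hor fun u =>
        (hC u).trans (K.hor_toConnection hK u).symm⟩
  · obtain ⟨Γ, hΓ⟩ := hK.exists_hasChristoffel
    have hJ := hΓ.apply_tangentStructure
    have hv : (K.toConnection hJ).verticalPart = K.toFun := by
      funext u
      ext ξ : 1
      change (FrechetGeom.split u ((FrechetGeom.split u).symm (0, K.toFun u ξ))).2 = _
      rw [LinearEquiv.apply_symm_apply]
    refine ⟨hJ, K.isCompl_ker_vert hJ, K.toConnection hJ,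
      ⟨hΓ.verticalPart_isLinear hv, hΓ.verticalPart_isSymmetric hv, K.hor_toConnection hJ,
        fun u ξ => by rw [FrechetGeom.Connection.TProj_L, hv]⟩,
      -- Only the condition on the horizontal spaces is needed for uniqueness.
      fun C hC => FrechetGeom.Connection.ext_of_hor fun u =>
        (hC.2.2.1 u).trans (K.hor_toConnection hJ u).symm⟩
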